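/- **Conventions.** For a first-order structure $M$, let $D(M^n)$ be the set of subsets of $M^n$ definable in $M$ with parameters. $M$ is *saturated* if for every $A\subseteq M$ with $|A|<|M|$, every set of formulas with parameters from $A$, in finitely many variables, each finite subset of which is realized in $M$, is itself realized in $M$. A function $\#:D(M)\to M$ is *uniformly definable* if for every parameter-free formula $\theta(x,\bar y)$ with $\bar y$ a non-empty tuple there is a parameter-free formula $\theta'(x,\bar y)$ such that for all $\bar a,b$ in $M$: $\#(\theta(\cdot,\bar a))=b$ if and only if $M\models\theta'(b,\bar a)$. Structures $(M,S_1,S_2,\dots,\#)$ with $S_n\subseteq P(M^n)$ and $\#:S_1\to M$ interpret a many-sorted language with object variables, $n$-ary relation variables for each $n\ge 1$ (ranging over $S_n$; the unary ones are called set variables), equality, membership of an $n$-tuple of objects in an $n$-ary relation, and terms $\#X$ for set variables $X$. A formula is *arithmetical* if it has no bound relation variables; a $\Sigma^1_1$-formula (resp. $\Pi^1_1$-formula) is an arithmetical formula preceded by finitely many existential (resp. universal) relation quantifiers of any arities. *Hume's Principle* is $\forall X\,\forall Y\,[\#X=\#Y\leftrightarrow\exists \text{ bijection } f:X\to Y]$,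 with $f$ a binary relation variable; *Basic Law V* is $\forall X\,\forall Y\,[\#X=\#Y\leftrightarrow X=Y]$. Comprehension for a formula $\varphi$ is $\exists R\,\forall\bar n\,[\bar n\in R\leftrightarrow\varphi(\bar n)]$. In all the schemas below, the formulas may contain further free object and relation variables, but $R$ is not free in them. * $\mathsf{\Delta^1_1\text{-}HP_0}$ consists of Hume's Principle and $\Delta^1_1$-comprehension: $[\forall\bar n\,(\varphi(\bar n)\leftrightarrow\psi(\bar n))]\to\exists R\,\forall\bar n\,[\bar n\in R\leftrightarrow\varphi(\bar n)]$ for $\varphi$ a $\Sigma^1_1$-formula and $\psi$ a $\Pi^1_1$-formula. $\mathsf{\Delta^1_1\text{-}BL_0}$ is the same with Basic Law V in place of Hume's Principle. * $\mathsf{\Pi^1_1\text{-}HP_0}$ consists of Hume's Principle and comprehension for $\Pi^1_1$-formulas. * $\mathsf{\Sigma^1_1\text{-}PH_0}$ consists of Hume's Principle, comprehension for arithmetical formulas, and $\Sigma^1_1$-choice: $[\forall\bar n\,\exists P\,\varphi(\bar n,P)]\to\exists R\,\forall\bar n\,\forall P\,[(\forall\bar m\,(\bar m\in P\leftrightarrow\bar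 n\bar m\in R))\to\varphi(\bar n,P)]$ for $\varphi$ a $\Sigma^1_1$-formula. **Theorem.** Let $k$ be an algebraically closed field of characteristic zero that is saturated as a structure in the language of rings. Every $X\in D(k)$ is finite or cofinite, and the function $\#:D(k)\to k$ given by $\#X=|X|$ if $X$ is finite and $\#X=-(|k\setminus X|+1)$ if $X$ is cofinite (integers being regarded as elements of $k$) is uniformly definable. The structure $(k,D(k),D(k^2),\dots,\#)$ is a model of $\mathsf{\Delta^1_1\text{-}HP_0}$, is not a model of $\mathsf{\Sigma^1_1\text{-}PH_0}$, and is not a model of $\mathsf{\Pi^1_1\text{-}HP_0}$. Further, there is no function $\partial:D(k)\to k$ such that $(k,D(k),D(k^2),\dots,\partial)$ is a model of $\mathsf{\Delta^1_1\text{-}BL_0}$. -/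

import Mathlib

universe u v w

/-! ## Definable sets, uniformly definable functions, saturated structures -/

namespace ModelTheoretic

/-- `D(M ^ n)`: the subsets of `M ^ n` definable in `M` with parameters from `M`.
Here `M ^ n` is `Fin n → M`; in particular a subset of `M` is a set of one-element tuples. -/
def definableSets (L : FirstOrder.Language.{u, v}) (M : Type w) [L.Structure M] (n : ℕ) :
    Set (Set (Fin n → M)) :=
  {X | (Set.univ : Set M).Definable L X}

/-- A formula `θ(x, y)` and parameters `a` define a member of `D(M ^ n)`. -/
theorem fiber_mem {L : FirstOrder.Language.{u, v}} {M : Type w} [L.Structure M] {n m : ℕ}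
    (θ : L.Formula (Fin n ⊕ Fin m)) (a : Fin m → M) :
    {x : Fin n → M | θ.Realize (Sum.elim x a)} ∈ definableSets L M n := by
  refine Set.definable_iff_exists_formula_sum.2
    ⟨θ.relabel (Sum.elim Sum.inr fun i => Sum.inl ⟨a i, Set.mem_univ _⟩), ?_⟩
  ext x
  simp only [Set.mem_ofPred_eq, FirstOrder.Language.Formula.realize_relabel]
  refine iff_of_eq (congrArg _ ?_)
  funext i
  cases i <;> rfl

/-- `θ(·, a)` as a member of `D(M ^ n)`. -/
def fiber {L : FirstOrder.Language.{u, v}} {M : Type w} [L.Structure M] {n m : ℕ}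
    (θ : L.Formula (Fin n ⊕ Fin m)) (a : Fin m → M) : definableSets L M n :=
  ⟨{x | θ.Realize (Sum.elim x a)}, fiber_mem θ a⟩

/-- `d : D(M) → M` is uniformly definable: for every parameter-free formula `θ(x, y)`, with `y` a
non-empty tuple of variables, there is a parameter-free formula `θ'(x, y)` such that
`d(θ(·, a)) = b` if and only if `M ⊨ θ'(b, a)`, for all `a` and `b` in `M`. -/
def UniformlyDefinable (L : FirstOrder.Language.{u, v}) (M : Type w) [L.Structure M]
    (d : definableSets L M 1 → M) : Prop :=
  ∀ (m : ℕ) (θ : L.Formula (Fin 1 ⊕ Fin (m + 1))),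
    ∃ θ' : L.Formula (Fin 1 ⊕ Fin (m + 1)),
      ∀ (a : Fin (m + 1) → M) (b : M),
        d (fiber θ a) = b ↔ θ'.Realize (Sum.elim ![b] a)

/-- `M` is saturated: for every `A ⊆ M` with `|A| < |M|`, every finitely realized set of formulas
with parameters from `A`, in finitely many variables, is realized. -/
def Saturated (L : FirstOrder.Language.{u, v}) (M : Type w) [L.Structure M] : Prop :=
  ∀ A : Set M, Cardinal.mk A < Cardinal.mk M →
    ∀ (n : ℕ) (p : Set ((L.withConstants A).Formula (Fin n))),
      (∀ q : Set ((L.withConstants A).Formula (Fin n)), q ⊆ p → q.Finite →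
        ∃ b : Fin n → M, ∀ θ ∈ q, θ.Realize b) →
      ∃ b : Fin n → M, ∀ θ ∈ p, θ.Realize b

end ModelTheoretic

/-! ## The many-sorted language of Hume's Principle and Basic Law V -/

namespace SecondOrder

/-- A structure `(M, S₁, S₂, …, #)` with `Sₙ ⊆ P(M ^ n)` for `n ≥ 1` and `# : S₁ → M`.
The sort of `(n + 1)`-ary relations is `rel n`. -/
structure Struct (M : Type u) where
  rel : (n : ℕ) → Set (Set (Fin (n + 1) → M))
  num : rel 0 → M

/-- Terms of the object sort: object variables, and `#X` for a set variable `X`. -/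
inductive Term where
  | obj (x : ℕ)
  | num (X : ℕ)

/-- Formulas. Object variables are indexed by `ℕ`, and so are the `(n + 1)`-ary relation variables
for each `n`; set variables are the unary relation variables (`n = 0`). -/
inductive Formula where
  | falsum
  | eq (t u : Term)
  | relEq (n : ℕ) (R S : ℕ)
  | mem (n : ℕ) (t : Fin (n + 1) → Term) (R : ℕ)
  | imp (φ ψ : Formula)
  | allObj (x : ℕ) (φ : Formula)
  | exObj (x : ℕ) (φ : Formula)
  | allRel (n : ℕ) (R : ℕ) (φ : Formula)
  | exRel (n : ℕ) (R : ℕ) (φ : Formula)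

namespace Formula

def not (φ : Formula) : Formula := φ.imp falsum

def and (φ ψ : Formula) : Formula := (φ.imp ψ.not).not

def iff (φ ψ : Formula) : Formula := (φ.imp ψ).and (ψ.imp φ)

/-- `∀ x₁ … ∀ xₙ φ`. -/
def allObjs {n : ℕ} (x : Fin n → ℕ) (φ : Formula) : Formula :=
  (List.ofFn x).foldr allObj φ

/-- `(x₁, …, xₙ₊₁) ∈ R` for object variables `xᵢ`. -/
def memVars {n : ℕ} (x : Fin (n + 1) → ℕ) (R : ℕ) : Formula :=
  mem n (fun i => Term.obj (x i)) R

end Formula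

/-- The set variable `Y` occurs in the term. -/
def Term.HasSetVar (Y : ℕ) : Term → Prop
  | .obj _ => False
  | .num X => X = Y

/-- The `(n + 1)`-ary relation variable `R` occurs free in the formula. -/
def Formula.RelFree (n R : ℕ) : Formula → Prop
  | .falsum => False
  | .eq t u => n = 0 ∧ (t.HasSetVar R ∨ u.HasSetVar R)
  | .relEq m S T => m = n ∧ (S = R ∨ T = R)
  | .mem m t S => (m = n ∧ S = R) ∨ (n = 0 ∧ ∃ i, (t i).HasSetVar R)
  | .imp φ ψ => φ.RelFree n R ∨ ψ.RelFree n R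
  | .allObj _ φ => φ.RelFree n R
  | .exObj _ φ => φ.RelFree n R
  | .allRel m S φ => ¬ (m = n ∧ S = R) ∧ φ.RelFree n R
  | .exRel m S φ => ¬ (m = n ∧ S = R) ∧ φ.RelFree n R

/-- Arithmetical formulas: no bound relation variables (free ones are allowed). -/
def Formula.IsArithmetical : Formula → Prop
  | .falsum => True
  | .eq _ _ => True
  | .relEq _ _ _ => True
  | .mem _ _ _ => True
  | .imp φ ψ => φ.IsArithmetical ∧ ψ.IsArithmetical
  | .allObj _ φ => φ.IsArithmetical
  | .exObj _ φ => φ.IsArithmetical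
  | .allRel _ _ _ => False
  | .exRel _ _ _ => False

/-- `Σ¹₁`-formulas: a block of existential relation quantifiers, of any arities, before an
arithmetical formula. -/
inductive Formula.IsSigma11 : Formula → Prop
  | arith {φ : Formula} : φ.IsArithmetical → IsSigma11 φ
  | exRel (n R : ℕ) {φ : Formula} : IsSigma11 φ → IsSigma11 (.exRel n R φ)

/-- `Π¹₁`-formulas: a block of universal relation quantifiers, of any arities, before an
arithmetical formula. -/
inductive Formula.IsPi11 : Formula → Prop
  | arith {φ : Formula} : φ.IsArithmetical → IsPi11 φ
  | allRel (n R : ℕ) {φ : Formula} : IsPi11 φ → IsPi11 (.allRel n R φ)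

/-! ### Satisfaction -/

/-- Values of the object variables and of the relation variables of each arity. -/
structure Assignment {M : Type u} (N : Struct M) where
  obj : ℕ → M
  rel : (n : ℕ) → ℕ → N.rel n

namespace Assignment

variable {M : Type u} {N : Struct M}

def updateObj (s : Assignment N) (x : ℕ) (a : M) : Assignment N where
  obj := Function.update s.obj x a
  rel := s.rel

def updateRel (s : Assignment N) (n R : ℕ) (A : N.rel n) : Assignment N where
  obj := s.obj
  rel := Function.update s.rel n (Function.update (s.rel n) R A)

end Assignment

def Term.eval {M : Type u} {N : Struct M} (s : Assignment N) : Term → M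
  | .obj x => s.obj x
  | .num X => N.num (s.rel 0 X)

def Formula.Sat {M : Type u} {N : Struct M} : Formula → Assignment N → Prop
  | .falsum, _ => False
  | .eq t u, s => t.eval s = u.eval s
  | .relEq n R S, s => s.rel n R = s.rel n S
  | .mem n t R, s => (fun i => (t i).eval s) ∈ (s.rel n R : Set (Fin (n + 1) → M))
  | .imp φ ψ, s => φ.Sat s → ψ.Sat s
  | .allObj x φ, s => ∀ a : M, φ.Sat (s.updateObj x a)
  | .exObj x φ, s => ∃ a : M, φ.Sat (s.updateObj x a)
  | .allRel n R φ, s => ∀ A : N.rel n, φ.Sat (s.updateRel n R A)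
  | .exRel n R φ, s => ∃ A : N.rel n, φ.Sat (s.updateRel n R A)

/-- `N ⊨ T`. Free variables of the axioms are read universally. -/
def Struct.Models {M : Type u} (N : Struct M) (T : Set Formula) : Prop :=
  ∀ φ ∈ T, ∀ s : Assignment N, φ.Sat s

/-! ### The axioms and theories -/

/-- The binary relation variable `f` is a bijection from the set variable `X` to the set
variable `Y`: it relates only members of `X` to members of `Y`, and is total, functional,
injective and surjective. -/
def bijection (f X Y : ℕ) : Formula :=
  let x : ℕ := 0
  let y : ℕ := 1
  let z : ℕ := 2
  let eqv (a b : ℕ) : Formula := .eq (.obj a) (.obj b)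
  let app (a b : ℕ) : Formula := Formula.memVars ![a, b] f
  let elt (a A : ℕ) : Formula := Formula.memVars ![a] A
  ((Formula.allObj x (.allObj y ((app x y).imp ((elt x X).and (elt y Y))))).and
    ((Formula.allObj x ((elt x X).imp (.exObj y (app x y)))).and
      ((Formula.allObj x (.allObj y (.allObj z (((app x y).and (app x z)).imp (eqv y z))))).and
        ((Formula.allObj x (.allObj y (.allObj z (((app x z).and (app y z)).imp (eqv x y))))).and
          (Formula.allObj y ((elt y Y).imp (.exObj x (app x y))))))))

/-- Hume's Principle: `#X = #Y` if and only if there is a bijection `f : X → Y`. -/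
def humesPrinciple : Formula :=
  .allRel 0 0 (.allRel 0 1
    ((Formula.eq (.num 0) (.num 1)).iff (.exRel 1 0 (bijection 0 0 1))))

/-- Basic Law V: `#X = #Y` if and only if `X = Y`. -/
def basicLawV : Formula :=
  .allRel 0 0 (.allRel 0 1 ((Formula.eq (.num 0) (.num 1)).iff (.relEq 0 0 1)))

/-- The formula `∃ R ∀ x ((x ∈ R) ↔ φ(x))`. -/
def comprehension {n : ℕ} (x : Fin (n + 1) → ℕ) (R : ℕ) (φ : Formula) : Formula :=
  .exRel n R (Formula.allObjs x ((Formula.memVars x R).iff φ))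

/-- Comprehension for the formulas in the class `C`. -/
def comprehensionSchema (C : Formula → Prop) : Set Formula :=
  {χ | ∃ (n : ℕ) (x : Fin (n + 1) → ℕ) (R : ℕ) (φ : Formula),
    Function.Injective x ∧ C φ ∧ ¬ φ.RelFree n R ∧ χ = comprehension x R φ}

/-- `Δ¹₁`-comprehension: `(∀ x (φ(x) ↔ ψ(x))) → ∃ R ∀ x ((x ∈ R) ↔ φ(x))` for `φ` a `Σ¹₁`-formula
and `ψ` a `Π¹₁`-formula. -/
def delta11Comprehension : Set Formula :=
  {χ | ∃ (n : ℕ) (x : Fin (n + 1) → ℕ) (R : ℕ) (φ ψ : Formula),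
    Function.Injective x ∧ φ.IsSigma11 ∧ ψ.IsPi11 ∧ ¬ φ.RelFree n R ∧ ¬ ψ.RelFree n R ∧
    χ = (Formula.allObjs x (φ.iff ψ)).imp (comprehension x R φ)}

/-- `Σ¹₁`-choice: `(∀ x ∃ P φ(x, P)) → ∃ R ∀ x ∀ P ((∀ y (y ∈ P ↔ (x, y) ∈ R)) → φ(x, P))` for `φ` a
`Σ¹₁`-formula; `x` and `y` are non-empty tuples of distinct object variables. -/
def sigma11Choice : Set Formula :=
  {χ | ∃ (n m : ℕ) (x : Fin (n + 1) → ℕ) (y : Fin (m + 1) → ℕ) (P R : ℕ) (φ : Formula),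
    Function.Injective (Fin.append x y) ∧ φ.IsSigma11 ∧ ¬ φ.RelFree (n + 1 + m) R ∧
    χ = (Formula.allObjs x (.exRel m P φ)).imp
      (.exRel (n + 1 + m) R (Formula.allObjs x (.allRel m P
        ((Formula.allObjs y ((Formula.memVars y P).iff
          (Formula.memVars (Fin.append (m := n + 1) (n := m + 1) x y) R))).imp φ))))}

/-- `AHP₀`. -/
def AHP : Set Formula := {humesPrinciple} ∪ comprehensionSchema Formula.IsArithmetical

/-- `Δ¹₁-HP₀`. -/
def Delta11HP : Set Formula := {humesPrinciple} ∪ delta11Comprehension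

/-- `Σ¹₁-PH₀`. -/
def Sigma11PH : Set Formula := AHP ∪ sigma11Choice

/-- `Π¹₁-HP₀`. -/
def Pi11HP : Set Formula := {humesPrinciple} ∪ comprehensionSchema Formula.IsPi11

/-- `Δ¹₁-BL₀`. -/
def Delta11BL : Set Formula := {basicLawV} ∪ delta11Comprehension

/-- The structure `(M, D(M), D(M²), …, d)` for `d : D(M) → M`. -/
def definableStruct (L : FirstOrder.Language.{u, v}) (M : Type w) [L.Structure M]
    (d : ModelTheoretic.definableSets L M 1 → M) : Struct M where
  rel n := ModelTheoretic.definableSets L M (n + 1)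
  num := d

end SecondOrder

/-! Saturation enters as compactness: a cover of `k^n` by sets definable over one fixed finite set
`A` has a finite subcover (`Saturated.exists_finite_subcover`). Any two elements transcendental over
`A` are conjugate over `A`, so an `A`-definable subset of `k` or its complement has only elements
algebraic over `A`. Root sets of polynomials cover it, so it is finite. Compactness also bounds,
uniformly in a definable family, the smaller of a set and its complement; hence `#` takes finitely
many values on the family and is definable.

Hume's Principle: the values n and -(m+1) never coincide in characteristic zero. Equinumerous finite
sets, and cofinite sets with equinumerous complements, have a bijection moving finitely many points
of the domain, which is definable. Conversely, a definable bijection between cofinite sets extends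
by an injection between the complements to a definable injection `k → k`, which Ax-Grothendieck
makes surjective; so the complements have the same size.

Δ¹₁-comprehension: a quantifier over definable relations is a disjunction, over all parameter-free
formulas, of quantifiers over tuples of parameters. So a Σ¹₁-formula defines a union of
`A`-definable sets with `A` finite. If the complement is such a union too, a finite subcover makes
the set definable.

The negative results: not being a value of `#` is Π¹₁, and its extension is neither finite nor
cofinite. Choice would give a definable square root, which an automorphism sending t to -t forbids.
Under Basic Law V, a ↦ ∂{a} is a definable injection, hence surjective, and so attains ∂∅. -/

/-! ### Closure properties of definable sets -/

namespace Set

open FirstOrder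

variable {L : Language} {M : Type*} [L.Structure M] {A : Set M} {α β : Type*}
  {P Q : (α → M) → Prop}

theorem definable_not (hP : A.Definable L {v | P v}) : A.Definable L {v | ¬ P v} :=
  hP.compl

theorem definable_and (hP : A.Definable L {v | P v}) (hQ : A.Definable L {v | Q v}) :
    A.Definable L {v | P v ∧ Q v} :=
  hP.inter hQ

theorem definable_or (hP : A.Definable L {v | P v}) (hQ : A.Definable L {v | Q v}) :
    A.Definable L {v | P v ∨ Q v} :=
  hP.union hQ

theorem definable_imp (hP : A.Definable L {v | P v}) (hQ : A.Definable L {v | Q v}) :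
    A.Definable L {v | P v → Q v} := by
  simpa only [imp_iff_not_or] using definable_or (definable_not hP) hQ

theorem definable_iff (hP : A.Definable L {v | P v}) (hQ : A.Definable L {v | Q v}) :
    A.Definable L {v | P v ↔ Q v} := by
  simpa only [iff_iff_implies_and_implies] using
    definable_and (definable_imp hP hQ) (definable_imp hQ hP)

theorem definable_const (p : Prop) : A.Definable L {_v : α → M | p} := by
  by_cases hp : p
  · simp [hp]
  · simp [hp]

theorem definable_coord_eq (i j : α) : A.Definable L {v : α → M | v i = v j} :=
  DefinableFun.ofPred_eq (DefinableFun.proj L) (DefinableFun.proj L)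

theorem definable_coord_eq_const (i : α) {a : M} (ha : a ∈ A) :
    A.Definable L {v : α → M | v i = a} :=
  (DefinableFun.proj L).ofPred_eq_const ha

theorem definable_comp (f : α → β) (hP : A.Definable L {v | P v}) :
    A.Definable L {v : β → M | P (v ∘ f)} :=
  hP.preimage_comp f

theorem definable_exists_tuple [Finite β] {P : (α → M) → (β → M) → Prop}
    (hP : A.Definable L {w : α ⊕ β → M | P (w ∘ Sum.inl) (w ∘ Sum.inr)}) :
    A.Definable L {v | ∃ u, P v u} := by
  simpa using! hP.exists_of_finite

theorem definable_forall_tuple [Finite β] {P : (α → M) → (β → M) → Prop}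
    (hP : A.Definable L {w : α ⊕ β → M | P (w ∘ Sum.inl) (w ∘ Sum.inr)}) :
    A.Definable L {v | ∀ u, P v u} := by
  simpa using! hP.forall_of_finite

theorem definable_exists {P : (α → M) → M → Prop}
    (hP : A.Definable L {w : α ⊕ Fin 1 → M | P (w ∘ Sum.inl) (w (Sum.inr 0))}) :
    A.Definable L {v | ∃ a, P v a} := by
  have h := definable_exists_tuple (β := Fin 1) (P := fun v u => P v (u 0)) hP
  convert h using 1
  ext v
  exact ⟨fun ⟨a, ha⟩ => ⟨fun _ => a, ha⟩, fun ⟨u, hu⟩ => ⟨u 0, hu⟩⟩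

theorem definable_forall {P : (α → M) → M → Prop}
    (hP : A.Definable L {w : α ⊕ Fin 1 → M | P (w ∘ Sum.inl) (w (Sum.inr 0))}) :
    A.Definable L {v | ∀ a, P v a} := by
  simpa only [not_exists, not_not] using
    definable_not (definable_exists (P := fun v a => ¬ P v a) (definable_not hP))

theorem definable_forall_index {ι : Type*} [Finite ι] {P : ι → (α → M) → Prop}
    (hP : ∀ i, A.Definable L {v | P i v}) : A.Definable L {v | ∀ i, P i v} := by
  rw [ofPred_forall]
  exact definable_iInter_of_finite hP

theorem definable_exists_index {ι : Type*} [Finite ι] {P : ι → (α → M) → Prop}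
    (hP : ∀ i, A.Definable L {v | P i v}) : A.Definable L {v | ∃ i, P i v} := by
  rw [ofPred_exists]
  exact definable_iUnion_of_finite hP

/-- A family of elements that is definable over `A` can be substituted for a variable. -/
theorem definable_subst {P : (α → M) → M → Prop} {g : (α → M) → M}
    (hg : A.Definable L {w : α ⊕ Fin 1 → M | g (w ∘ Sum.inl) = w (Sum.inr 0)})
    (hP : A.Definable L {w : α ⊕ Fin 1 → M | P (w ∘ Sum.inl) (w (Sum.inr 0))}) :
    A.Definable L {v | P v (g v)} := by
  have h := definable_exists (P := fun v a => g v = a ∧ P v a) (definable_and hg hP)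
  simpa using! h

theorem definable_of_finite [Finite α] {X : Set (α → M)} (hX : X.Finite) :
    (univ : Set M).Definable L X := by
  have := hX.to_subtype
  have h : (univ : Set M).Definable L {v | ∃ x : X, ∀ i, v i = x.1 i} :=
    definable_exists_index fun x => definable_forall_index fun i =>
      definable_coord_eq_const i (mem_univ _)
  convert h using 1
  ext v
  exact ⟨fun hv => ⟨⟨v, hv⟩, fun _ => rfl⟩, fun ⟨x, hx⟩ => funext hx ▸ x.2⟩

/-- Members of an `A`-definable set are moved into the set by automorphisms that fix `A`. -/
theorem Definable.map_mem {X : Set (α → M)} (hX : A.Definable L X) (σ : L.Equiv M M)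
    (hσ : ∀ a ∈ A, σ a = a) {v : α → M} (hv : v ∈ X) : σ ∘ v ∈ X := by
  obtain ⟨φ, rfl⟩ := definable_iff_exists_formula_sum.1 hX
  rw [mem_ofPred_eq] at hv ⊢
  have h := (Language.StrongHomClass.realize_formula σ φ).2 hv
  convert h using 1
  funext i
  rcases i with a | i
  · exact (hσ a a.2).symm
  · rfl

end Set

/-! ### Compactness from saturation -/

namespace ModelTheoretic

open Set

variable {L : FirstOrder.Language} {M : Type*} [L.Structure M] {A : Set M} {α : Type*}

/-- A finite `A` is smaller than the infinite `M`, so saturation applies to the type of all formulas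
over `A` whose solution set, after renaming coordinates, lies in `C`. -/
theorem Saturated.sInter_nonempty [Infinite M] (hM : Saturated L M) (hA : A.Finite) [Finite α]
    {C : Set (Set (α → M))} (hC : ∀ S ∈ C, A.Definable L S)
    (hfin : ∀ D ⊆ C, D.Finite → (⋂₀ D).Nonempty) : (⋂₀ C).Nonempty := by
  obtain ⟨n, ⟨e⟩⟩ := Finite.exists_equiv_fin α
  let R : (L.withConstants A).Formula (Fin n) → Set (α → M) := fun φ => {v | φ.Realize (v ∘ e.symm)}
  have hcard : Cardinal.mk A < Cardinal.mk M :=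
    (Cardinal.lt_aleph0_iff_set_finite.2 hA).trans_le (Cardinal.aleph0_le_mk M)
  obtain ⟨b, hb⟩ := hM A hcard n {φ | R φ ∈ C} fun q hq hqf => by
    obtain ⟨v, hv⟩ := hfin (R '' q) (by rintro _ ⟨φ, hφ, rfl⟩; exact hq hφ) (hqf.image R)
    exact ⟨v ∘ e.symm, fun θ hθ => hv _ ⟨θ, hθ, rfl⟩⟩
  refine ⟨b ∘ e, fun S hS => ?_⟩
  obtain ⟨φ, hφ⟩ := hC S hS
  have hR : R (φ.relabel e) = S := by
    ext v
    simp [R, hφ, FirstOrder.Language.Formula.realize_relabel, Function.comp_def]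
  have := hb (φ.relabel e) (by rw [mem_ofPred_eq, hR]; exact hS)
  rw [hφ, mem_ofPred_eq]
  exact FirstOrder.Language.Formula.realize_relabel.1 this

/-- The finite intersection property, applied to complements. One finite `A` has to serve all
members of `C`; later arguments keep track of parameters for this reason. -/
theorem Saturated.exists_finite_subcover [Infinite M] (hM : Saturated L M) (hA : A.Finite)
    [Finite α] {C : Set (Set (α → M))} (hC : ∀ S ∈ C, A.Definable L S) (hcov : ⋃₀ C = univ) :
    ∃ D ⊆ C, D.Finite ∧ ⋃₀ D = univ := by
  by_contra! hD
  obtain ⟨v, hv⟩ := hM.sInter_nonempty hA (C := compl '' C)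
    (by rintro _ ⟨S, hS, rfl⟩; exact (hC S hS).compl) fun D hDC hDf => by
      have h := hD (compl '' D)
        (by rintro _ ⟨S, hS, rfl⟩; obtain ⟨T, hT, rfl⟩ := hDC hS; simpa using hT) (hDf.image _)
      rwa [← nonempty_compl, compl_sUnion, ← image_comp, compl_comp_compl, image_id] at h
  obtain ⟨S, hS, hvS⟩ := (hcov ▸ mem_univ v : v ∈ ⋃₀ C)
  exact hv _ ⟨S, hS, rfl⟩ hvS

end ModelTheoretic

/-! ### Automorphisms of algebraically closed fields -/

section Automorphisms

variable {R K : Type*} [CommRing R] [Field K] [Algebra R K]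

/-- Extend {a, b} to a transcendence basis. Transposing a and b gives an isomorphism of the
subalgebras generated by the two enumerations of the basis, and `K` is an algebraic closure of both,
so the isomorphism extends. -/
theorem IsAlgClosed.exists_algEquiv_swap [IsAlgClosed K] {a b : K}
    (h : AlgebraicIndepOn R id ({a, b} : Set K)) : ∃ σ : K ≃ₐ[R] K, σ a = b := by
  classical
  obtain ⟨t, hst, ht⟩ := exists_isTranscendenceBasis_superset h
  let a' : t := ⟨a, hst (by simp)⟩
  let b' : t := ⟨b, hst (by simp)⟩
  let v : t → K := Subtype.val
  let w : t → K := v ∘ Equiv.swap a' b'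
  have hw : IsTranscendenceBasis R w := ht.comp_equiv (Equiv.swap a' b')
  let := isAlgClosure_of_transcendence_basis v ht
  let := isAlgClosure_of_transcendence_basis w hw
  let e : Algebra.adjoin R (Set.range v) ≃ₐ[R] Algebra.adjoin R (Set.range w) :=
    ht.1.aevalEquiv.symm.trans hw.1.aevalEquiv
  let σ := IsAlgClosure.equivOfEquiv K K e.toRingEquiv
  have hσ : ∀ s : Algebra.adjoin R (Set.range v), σ (s : K) = (e s : K) := fun s =>
    IsAlgClosure.equivOfEquiv_algebraMap K K e.toRingEquiv s
  refine ⟨{ σ with commutes' := fun r => ?_ }, ?_⟩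
  · exact (hσ (algebraMap R _ r)).trans (by rw [e.commutes]; rfl)
  · have h1 : ht.1.aevalEquiv (MvPolynomial.X a') =
        (⟨a, Algebra.subset_adjoin ⟨a', rfl⟩⟩ : Algebra.adjoin R (Set.range v)) := by
      ext
      simp [a']
    have h2 := hσ ⟨a, Algebra.subset_adjoin ⟨a', rfl⟩⟩
    refine h2.trans ?_
    rw [← h1]
    simp [e, w, v, b']

theorem Transcendental.anti {S T : Subring K} (h : S ≤ T) {x : K} (hx : Transcendental T x) :
    Transcendental S x :=
  hx.of_ringHom_of_comp_eq (Subring.inclusion h) (RingHom.id K) (Subring.inclusion_injective h) rfl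

theorem IsAlgClosed.exists_ringEquiv_of_transcendental_insert [IsAlgClosed K] {A : Set K} {a b : K}
    (ha : Transcendental (Subring.closure A) a)
    (hb : Transcendental (Subring.closure (insert a A)) b) :
    ∃ σ : K ≃+* K, (∀ x ∈ A, σ x = x) ∧ σ a = b := by
  have hle : (Algebra.adjoin (Subring.closure A) ({a} : Set K)).toSubring ≤
      Subring.closure (insert a A) := by
    intro x hx
    induction hx using Algebra.adjoin_induction with
    | mem x hx => exact Subring.subset_closure (Set.mem_insert_iff.2 (Or.inl hx))
    | algebraMap r => exact Subring.closure_mono (Set.subset_insert a A) r.2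
    | add x y _ _ hx hy => exact add_mem hx hy
    | mul x y _ _ hx hy => exact mul_mem hx hy
  have hb' : Transcendental (Algebra.adjoin (Subring.closure A) ({a} : Set K)) b :=
    Transcendental.anti hle hb
  have h1 : AlgebraicIndepOn (Subring.closure A) id ({a} : Set K) := by
    have := (algebraicIndependent_singleton_iff (R := Subring.closure A)
      (x := fun i : ({a} : Set K) => (i : K)) ⟨a, rfl⟩).2 ha
    exact this
  have h2 : AlgebraicIndepOn (Subring.closure A) id ({a, b} : Set K) := by
    rw [Set.pair_comm]
    exact h1.insert (by rw [Set.image_id]; exact hb')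
  obtain ⟨σ, hσ⟩ := exists_algEquiv_swap h2
  exact ⟨σ.toRingEquiv, fun x hx => σ.commutes ⟨x, Subring.subset_closure hx⟩, hσ⟩

end Automorphisms

/-! ### Definability of polynomial conditions -/

namespace FirstOrder.Ring

open FirstOrder.Language

variable {K : Type*} [Field K] [CompatibleRing K] {A : Set K}

theorem exists_term_of_mem_closure {c : K} (hc : c ∈ Subring.closure A) :
    ∃ t : ring.Term A, t.realize Subtype.val = c := by
  induction hc using Subring.closure_induction with
  | mem x hx => exact ⟨.var ⟨x, hx⟩, rfl⟩
  | zero => exact ⟨0, by simp⟩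
  | one => exact ⟨1, by simp⟩
  | add x y _ _ hx hy =>
    obtain ⟨s, rfl⟩ := hx
    obtain ⟨t, rfl⟩ := hy
    exact ⟨s + t, by simp⟩
  | neg x _ hx =>
    obtain ⟨s, rfl⟩ := hx
    exact ⟨-s, by simp⟩
  | mul x y _ _ hx hy =>
    obtain ⟨s, rfl⟩ := hx
    obtain ⟨t, rfl⟩ := hy
    exact ⟨s * t, by simp⟩

theorem definable_eq_of_mem_closure {α : Type*} (i : α) {c : K} (hc : c ∈ Subring.closure A) :
    A.Definable ring {v : α → K | v i = c} := by
  obtain ⟨t, rfl⟩ := exists_term_of_mem_closure hc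
  refine Set.definable_iff_exists_formula_sum.2
    ⟨(Term.var (Sum.inr i)).equal (t.relabel Sum.inl), ?_⟩
  ext v
  simp [Function.comp_def]

theorem exists_term_of_polynomial (p : Polynomial (Subring.closure A)) :
    ∃ t : ring.Term (A ⊕ Fin 1), ∀ v : Fin 1 → K,
      t.realize (Sum.elim Subtype.val v) = Polynomial.aeval (v 0) p := by
  induction p using Polynomial.induction_on' with
  | add p q hp hq =>
    obtain ⟨s, hs⟩ := hp
    obtain ⟨t, ht⟩ := hq
    exact ⟨s + t, by simp [hs, ht]⟩
  | monomial n c =>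
    obtain ⟨t, ht⟩ := exists_term_of_mem_closure c.2
    induction n with
    | zero => exact ⟨t.relabel Sum.inl, fun v => by
        simpa [Function.comp_def, Polynomial.aeval_monomial] using! ht⟩
    | succ n ih =>
      obtain ⟨s, hs⟩ := ih
      refine ⟨s * .var (Sum.inr 0), fun v => ?_⟩
      simp [hs, Polynomial.aeval_monomial, pow_succ, mul_assoc]

theorem definable_roots (p : Polynomial (Subring.closure A)) :
    A.Definable ring {v : Fin 1 → K | Polynomial.aeval (v 0) p = 0} := by
  obtain ⟨t, ht⟩ := exists_term_of_polynomial p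
  refine Set.definable_iff_exists_formula_sum.2 ⟨t.equal 0, ?_⟩
  ext v
  simp [ht]

end FirstOrder.Ring

/-! ### Strong minimality -/

namespace ModelTheoretic

open Set FirstOrder.Language

variable {K : Type*} [Field K] {A : Set K}

theorem finite_roots {p : Polynomial (Subring.closure A)} (hp : p ≠ 0) :
    {v : Fin 1 → K | Polynomial.aeval (v 0) p = 0}.Finite := by
  classical
  have hp' : p.map (algebraMap (Subring.closure A) K) ≠ 0 :=
    (Polynomial.map_ne_zero_iff Subtype.val_injective).2 hp
  refine ((p.map (algebraMap (Subring.closure A) K)).roots.toFinset.finite_toSet.preimage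
    (f := fun v : Fin 1 → K => v 0) ?_).subset fun v hv => ?_
  · intro v _ w _ h
    ext i
    rwa [Subsingleton.elim i 0]
  · simpa [hp', Polynomial.aeval_def, Polynomial.eval_map] using hv

variable [FirstOrder.Ring.CompatibleRing K]

/-- A definable set whose members are algebraic over the parameters is finite. -/
theorem Saturated.finite_of_isAlgebraic [Infinite K] (hK : Saturated ring K) (hA : A.Finite)
    {X : Set (Fin 1 → K)} (hX : A.Definable ring X)
    (halg : ∀ v ∈ X, IsAlgebraic (Subring.closure A) (v 0)) : X.Finite := by
  -- Root sets cover `X` and `Xᶜ` covers the rest; in a finite subcover, only the root sets can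
  -- contain points of `X`.
  let C : Set (Set (Fin 1 → K)) := insert Xᶜ {S | ∃ p : Polynomial (Subring.closure A),
    p ≠ 0 ∧ S = {v : Fin 1 → K | Polynomial.aeval (v 0) p = 0}}
  obtain ⟨D, hDC, hDf, hD⟩ := hK.exists_finite_subcover hA (C := C)
    (by
      rintro S (rfl | ⟨p, hp, rfl⟩)
      · exact hX.compl
      · exact FirstOrder.Ring.definable_roots p)
    (by
      refine eq_univ_of_forall fun v => ?_
      by_cases hv : v ∈ X
      · obtain ⟨p, hp, hpv⟩ := halg v hv
        exact ⟨_, Or.inr ⟨p, hp, rfl⟩, hpv⟩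
      · exact ⟨_, Or.inl rfl, hv⟩)
  refine (hDf.sdiff (t := {Xᶜ})).sUnion (fun S hS => ?_) |>.subset fun v hv => ?_
  · rcases hDC hS.1 with h | ⟨p, hp, rfl⟩
    · exact absurd h hS.2
    · exact finite_roots hp
  · obtain ⟨S, hS, hvS⟩ := (hD ▸ mem_univ v : v ∈ ⋃₀ D)
    exact ⟨S, ⟨hS, fun h => (h ▸ hvS : v ∈ Xᶜ) hv⟩, hvS⟩

theorem Saturated.exists_transcendental [Infinite K] (hK : Saturated ring K) (hA : A.Finite) :
    ∃ c : K, Transcendental (Subring.closure A) c := by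
  by_contra! h
  have := hK.finite_of_isAlgebraic hA (X := univ) definable_univ fun v _ => by
    simpa [Transcendental] using h (v 0)
  exact infinite_univ this

/-- Since a and b may be algebraically dependent over `A`, the automorphism passes through some c
transcendental over `A ∪ {a, b}`: move a to c, then c back to b. -/
theorem Saturated.exists_ringEquiv [IsAlgClosed K] (hK : Saturated ring K) (hA : A.Finite)
    {a b : K} (ha : Transcendental (Subring.closure A) a)
    (hb : Transcendental (Subring.closure A) b) :
    ∃ σ : K ≃+* K, (∀ x ∈ A, σ x = x) ∧ σ a = b := by
  have := IsAlgClosed.instInfinite (K := K)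
  obtain ⟨c, hc⟩ := hK.exists_transcendental ((hA.insert b).insert a)
  have hca := hc.anti (Subring.closure_mono (insert_subset_insert (subset_insert b A)))
  have hcb := hc.anti (Subring.closure_mono (subset_insert a (insert b A)))
  obtain ⟨σ, hσA, hσ⟩ := IsAlgClosed.exists_ringEquiv_of_transcendental_insert ha hca
  obtain ⟨τ, hτA, hτ⟩ := IsAlgClosed.exists_ringEquiv_of_transcendental_insert hb hcb
  refine ⟨σ.trans τ.symm, fun x hx => ?_, ?_⟩
  · rw [RingEquiv.trans_apply, hσA x hx, RingEquiv.symm_apply_eq, hτA x hx]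
  · rw [RingEquiv.trans_apply, hσ, RingEquiv.symm_apply_eq, hτ]

theorem _root_.Set.Definable.map_mem_of_ringEquiv {α : Type*} {X : Set (α → K)}
    (hX : A.Definable ring X) (σ : K ≃+* K) (hσ : ∀ a ∈ A, σ a = a) {v : α → K} (hv : v ∈ X) :
    σ ∘ v ∈ X :=
  hX.map_mem (FirstOrder.Ring.languageEquivEquivRingEquiv.symm σ) hσ hv

/-- Saturated algebraically closed fields are strongly minimal. -/
theorem Saturated.finite_or_finite_compl [IsAlgClosed K] (hK : Saturated ring K)
    {X : Set (Fin 1 → K)} (hX : (univ : Set K).Definable ring X) : X.Finite ∨ Xᶜ.Finite := by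
  have := IsAlgClosed.instInfinite (K := K)
  obtain ⟨A, -, hXA⟩ := definable_iff_finitely_definable.1 hX
  by_cases h : ∀ v ∈ X, IsAlgebraic (Subring.closure (A : Set K)) (v 0)
  · exact Or.inl (hK.finite_of_isAlgebraic A.finite_toSet hXA h)
  · push Not at h
    obtain ⟨v, hv, hvt⟩ := h
    -- All transcendental elements are conjugate to `v 0`, so they belong to `X`, and the complement
    -- is algebraic over `A`.
    refine Or.inr (hK.finite_of_isAlgebraic A.finite_toSet hXA.compl fun w hw => ?_)
    by_contra hwt
    obtain ⟨σ, hσA, hσ⟩ := hK.exists_ringEquiv A.finite_toSet hvt hwt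
    refine hw ?_
    convert hXA.map_mem_of_ringEquiv σ hσA hv using 1
    ext i
    rw [Subsingleton.elim i 0]
    exact hσ.symm

end ModelTheoretic

/-! ### Ax-Grothendieck for definable functions of one variable -/

namespace FirstOrder.Ring

open FirstOrder.Language FirstOrder.Field Set

variable {β : Type} [Finite β]

/-- For all values of the parameters, if `θ` defines the graph of an injective function then this
function is surjective. -/
noncomputable def surjectiveOfInjective (θ : ring.Formula (β ⊕ Fin 2)) : ring.Sentence :=
  let total : ring.Formula β := Formula.iAlls (Fin 1) (Formula.iExs (Fin 1)
    (θ.relabel (Sum.elim (Sum.inl ∘ Sum.inl) ![Sum.inl (Sum.inr 0), Sum.inr 0])))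
  let functional : ring.Formula β := Formula.iAlls (Fin 3)
    ((θ.relabel (Sum.elim Sum.inl ![Sum.inr 0, Sum.inr 1])).imp
      ((θ.relabel (Sum.elim Sum.inl ![Sum.inr 0, Sum.inr 2])).imp
        ((Term.var (Sum.inr 1)).equal (.var (Sum.inr 2)))))
  let injective : ring.Formula β := Formula.iAlls (Fin 3)
    ((θ.relabel (Sum.elim Sum.inl ![Sum.inr 0, Sum.inr 2])).imp
      ((θ.relabel (Sum.elim Sum.inl ![Sum.inr 1, Sum.inr 2])).imp
        ((Term.var (Sum.inr 0)).equal (.var (Sum.inr 1)))))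
  let surjective : ring.Formula β := Formula.iAlls (Fin 1) (Formula.iExs (Fin 1)
    (θ.relabel (Sum.elim (Sum.inl ∘ Sum.inl) ![Sum.inr 0, Sum.inl (Sum.inr 0)])))
  Formula.iAlls β ((total.imp (functional.imp (injective.imp surjective))).relabel Sum.inr)

theorem realize_surjectiveOfInjective {K : Type*} [ring.Structure K]
    (θ : ring.Formula (β ⊕ Fin 2)) :
    K ⊨ surjectiveOfInjective θ ↔ ∀ (a : β → K) (f : K → K),
      (∀ x y, θ.Realize (Sum.elim a ![x, y]) ↔ f x = y) → Function.Injective f →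
        Function.Surjective f := by
  have hcomp : ∀ {γ V : Type} (w : V → K) (e : γ → V) (i j : V),
      w ∘ Sum.elim e ![i, j] = Sum.elim (w ∘ e) ![w i, w j] := by
    intro γ V w e i j
    rw [Sum.comp_elim]
    congr 1
    funext l
    fin_cases l <;> rfl
  have hone : ∀ {P : K → Prop}, (∀ u : Fin 1 → K, P (u 0)) ↔ ∀ x, P x :=
    ⟨fun h x => h fun _ => x, fun h u => h _⟩
  have hone' : ∀ {P : K → Prop}, (∃ u : Fin 1 → K, P (u 0)) ↔ ∃ x, P x :=
    ⟨fun ⟨u, h⟩ => ⟨_, h⟩, fun ⟨x, h⟩ => ⟨fun _ => x, h⟩⟩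
  have hthree : ∀ {P : K → K → K → Prop}, (∀ u : Fin 3 → K, P (u 0) (u 1) (u 2)) ↔
      ∀ x y z, P x y z :=
    ⟨fun h x y z => h ![x, y, z], fun h u => h _ _ _⟩
  have key : K ⊨ surjectiveOfInjective θ ↔ ∀ a : β → K,
      (∀ x, ∃ y, θ.Realize (Sum.elim a ![x, y])) →
      (∀ x y z, θ.Realize (Sum.elim a ![x, y]) → θ.Realize (Sum.elim a ![x, z]) → y = z) →
      (∀ x y z, θ.Realize (Sum.elim a ![x, z]) → θ.Realize (Sum.elim a ![y, z]) → x = y) →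
      ∀ y, ∃ x, θ.Realize (Sum.elim a ![x, y]) := by
    simp only [surjectiveOfInjective, Sentence.Realize, Formula.realize_iAlls,
      Formula.realize_relabel, Formula.realize_imp, Formula.realize_iExs, hcomp,
      Formula.realize_equal, Term.realize_var, Sum.elim_inr, Sum.elim_inl, Sum.elim_comp_inl,
      Sum.elim_comp_inr, ← Function.comp_assoc]
    refine forall_congr' fun a => ?_
    rw [← hthree, ← hthree, ← hone, ← hone]
    refine imp_congr (forall_congr' fun u =>
      hone' (P := fun y => θ.Realize (Sum.elim a ![u 0, y]))) (imp_congr Iff.rfl (imp_congr Iff.rfl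
      (forall_congr' fun u => hone' (P := fun x => θ.Realize (Sum.elim a ![x, u 0])))))
  rw [key]
  refine forall_congr' fun a => ⟨fun h f hf hinj y => ?_, fun h ht hfun hinj y => ?_⟩
  · simp only [hf] at h
    exact h (fun x => ⟨_, rfl⟩) (fun x y z hy hz => hy.symm.trans hz)
      (fun x y z hx hy => hinj (hx.trans hy.symm)) y
  · choose f hf using ht
    have hf' : ∀ x y, θ.Realize (Sum.elim a ![x, y]) ↔ f x = y := fun x y =>
      ⟨fun hxy => hfun x _ _ (hf x) hxy, fun hxy => hxy ▸ hf x⟩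
    obtain ⟨x, hx⟩ := h f hf' (fun x x' hxx' => hinj x x' (f x) (hf x) (hxx' ▸ hf x')) y
    exact ⟨x, (hf' x y).2 hx⟩

/-- A finite set of algebraic elements generates a finite field over `ZMod p`, of order p^n for some
n > 0. -/
theorem exists_iterateFrobenius_fixed (p : ℕ) [Fact p.Prime] {S : Set (AlgebraicClosure (ZMod p))}
    (hS : S.Finite) : ∃ n, 0 < n ∧ ∀ x ∈ S, x ^ p ^ n = x := by
  have := hS.to_subtype
  let E := IntermediateField.adjoin (ZMod p) S
  have : FiniteDimensional (ZMod p) E := IntermediateField.finiteDimensional_adjoin fun x _ =>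
    Algebra.IsIntegral.isIntegral x
  have : Finite E := Module.finite_of_finite (ZMod p)
  have := Fintype.ofFinite E
  obtain ⟨n, -, hn⟩ := FiniteField.card E p
  refine ⟨n, n.pos, fun x hx => ?_⟩
  have := FiniteField.pow_card (⟨x, IntermediateField.subset_adjoin _ _ hx⟩ : E)
  rw [hn] at this
  exact congrArg Subtype.val this

theorem finite_pow_eq_self {K : Type*} [Field K] {m : ℕ} (hm : 1 < m) :
    {x : K | x ^ m = x}.Finite := by
  classical
  have hp : (Polynomial.X ^ m - Polynomial.X : Polynomial K) ≠ 0 :=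
    FiniteField.X_pow_card_sub_X_ne_zero K hm
  refine (Polynomial.X ^ m - Polynomial.X : Polynomial K).roots.toFinset.finite_toSet.subset
    fun x hx => ?_
  simp only [mem_ofPred_eq] at hx
  simp [hp, hx]

/-- Some power of Frobenius fixes the parameters and the target y. It preserves the graph of f, so f
maps its finite fixed set `F` to itself; being injective, f permutes `F` and attains y. -/
theorem realize_surjectiveOfInjective_prime (p : ℕ) [Fact p.Prime]
    [CompatibleRing (AlgebraicClosure (ZMod p))] (θ : ring.Formula (β ⊕ Fin 2)) :
    AlgebraicClosure (ZMod p) ⊨ surjectiveOfInjective θ := by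
  rw [realize_surjectiveOfInjective]
  intro a f hf hinj y
  obtain ⟨n, hn, hfix⟩ := exists_iterateFrobenius_fixed p ((finite_range a).insert y)
  let F : Set (AlgebraicClosure (ZMod p)) := {x | x ^ p ^ n = x}
  have hF : F.Finite := finite_pow_eq_self (Nat.one_lt_pow hn.ne' (Fact.out : p.Prime).one_lt)
  let σ := languageEquivEquivRingEquiv.symm (iterateFrobeniusEquiv (AlgebraicClosure (ZMod p)) p n)
  have hσ : ∀ x, σ x = x ^ p ^ n := fun x => rfl
  have hmaps : MapsTo f F F := by
    intro x hx
    have h := (StrongHomClass.realize_formula σ θ).2 ((hf x (f x)).2 rfl)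
    have hcomp : σ ∘ Sum.elim a ![x, f x] = Sum.elim a ![x, f x ^ p ^ n] := by
      funext i
      rcases i with i | i
      · exact hfix _ (mem_insert_of_mem _ (mem_range_self i))
      · fin_cases i
        · exact hx
        · rfl
    rw [hcomp, hf] at h
    exact h.symm
  obtain ⟨x, -, hx⟩ := ((hF.injOn_iff_bijOn_of_mapsTo hmaps).1 hinj.injOn).surjOn
    (hfix y (mem_insert y _))
  exact ⟨x, hx⟩

/-- The **Ax-Grothendieck** theorem for definable functions of one variable. -/
theorem surjective_of_injective_of_definable {K : Type*} [Field K] [IsAlgClosed K] [CharZero K]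
    [CompatibleRing K] {A : Set K} {f : K → K}
    (hf : A.Definable ring {v : Fin 2 → K | f (v 0) = v 1}) (hinj : Function.Injective f) :
    Function.Surjective f := by
  obtain ⟨B, -, hB⟩ := definable_iff_finitely_definable.1 hf
  obtain ⟨θ, hθ⟩ := definable_iff_exists_formula_sum.1 hB
  obtain ⟨m, ⟨e⟩⟩ := Finite.exists_equiv_fin B
  let θ' : ring.Formula (Fin m ⊕ Fin 2) := θ.relabel (Sum.map e id)
  -- The parameters have become variables quantified in the sentence, so it transfers to `K`: ACF₀
  -- is complete and proves whatever holds in ACF_p for infinitely many primes p.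
  have h0 : K ⊨ surjectiveOfInjective θ' := by
    rw [(ACF_isComplete (Or.inr rfl)).realize_sentence_iff _ K,
      ACF_zero_realize_iff_infinite_ACF_prime_realize]
    convert! Set.infinite_univ (α := Nat.Primes)
    rw [Set.eq_univ_iff_forall]
    rintro ⟨p, hp⟩
    have : Fact p.Prime := ⟨hp⟩
    let := compatibleRingOfRing (AlgebraicClosure (ZMod p))
    exact ((ACF_isComplete (Or.inl hp)).realize_sentence_iff _ (AlgebraicClosure (ZMod p))).1
      (realize_surjectiveOfInjective_prime p θ')
  refine (realize_surjectiveOfInjective θ').1 h0 (fun i => (e.symm i : K)) f (fun x y => ?_) hinj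
  have h1 : f x = y ↔ (![x, y] : Fin 2 → K) ∈ {v : Fin 2 → K | f (v 0) = v 1} := Iff.rfl
  rw [h1, hθ, Formula.realize_relabel, mem_ofPred_eq]
  refine iff_of_eq (congrArg _ ?_)
  funext i
  rcases i with i | i <;> simp

end FirstOrder.Ring

/-! ### Definable families and definability of the numerosity -/

namespace ModelTheoretic

open Set FirstOrder.Language

section Families

variable {L : FirstOrder.Language} {M : Type*} [L.Structure M] {A B : Set M} {α β γ : Type*}

/-- The sets `X v`, for a tuple `v`, are uniformly definable over `A`. -/
def DefinableFamily (L : FirstOrder.Language) {M : Type*} [L.Structure M] (A : Set M)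
    {α β : Type*} (X : (α → M) → Set (β → M)) : Prop :=
  A.Definable L {w : β ⊕ α → M | w ∘ Sum.inl ∈ X (w ∘ Sum.inr)}

namespace DefinableFamily

variable {X Y : (α → M) → Set (β → M)}

theorem compl (hX : DefinableFamily L A X) : DefinableFamily L A fun v => (X v)ᶜ :=
  Definable.compl hX

theorem comp (hX : DefinableFamily L A X) (f : α → γ) :
    DefinableFamily L A fun v : γ → M => X (v ∘ f) :=
  definable_comp (Sum.map id f) hX

theorem mem (hX : DefinableFamily L A X) (x : β → γ) (f : α → γ) :
    A.Definable L {v : γ → M | v ∘ x ∈ X (v ∘ f)} :=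
  definable_comp (Sum.elim x f) hX

theorem const {S : Set (β → M)} (hS : A.Definable L S) :
    DefinableFamily L A fun _ : α → M => S :=
  definable_comp Sum.inl hS

theorem fiber [Finite α] [Finite β] (hX : DefinableFamily L A X) (v : α → M) :
    (univ : Set M).Definable L (X v) := by
  have h : (univ : Set M).DefinableMap L fun x : β → M => (Sum.elim x v : β ⊕ α → M) := by
    rintro (i | i)
    · exact DefinableFun.proj L
    · exact L.definableFun_const _ (mem_univ _)
  exact (Definable.mono hX (subset_univ A)).preimage_map h

theorem definable_eq [Finite β] (hX : DefinableFamily L A X) (hY : DefinableFamily L A Y) :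
    A.Definable L {v | X v = Y v} := by
  simp only [Set.ext_iff]
  exact definable_forall_tuple (definable_iff (hX.mem Sum.inr Sum.inl) (hY.mem Sum.inr Sum.inl))

end DefinableFamily

/-- For fixed n this bound is first-order: the n distinct elements form one tuple of variables. -/
theorem le_encard_iff {X : Set (Fin 1 → M)} (n : ℕ) : (n : ℕ∞) ≤ X.encard ↔
    ∃ u : Fin n → M, (∀ i j, u i = u j → i = j) ∧ ∀ i, (fun _ => u i) ∈ X := by
  constructor
  · intro h
    obtain ⟨t, htX, ht⟩ := exists_subset_encard_eq h
    have htf : t.Finite := finite_of_encard_eq_coe ht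
    have := htf.to_subtype
    have hcard : Nat.card t = n := by
      rw [← htf.cast_ncard_eq, Nat.cast_inj] at ht
      exact ht
    let e : Fin n ≃ t := (finCongr hcard.symm).trans (Finite.equivFin t).symm
    have he : ∀ i, (fun _ => (e i).1 0) = (e i).1 := fun i =>
      funext fun j => congrArg _ (Subsingleton.elim _ _)
    refine ⟨fun i => (e i).1 0, fun i j hij => e.injective (Subtype.ext ?_), fun i => ?_⟩
    · exact (he i).symm.trans ((funext fun _ => hij).trans (he j))
    · rw [he i]
      exact htX (e i).2
  · rintro ⟨u, hu, huX⟩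
    let f : Fin n → X := fun i => ⟨fun _ => u i, huX i⟩
    have hf : Function.Injective f := fun i j hij =>
      hu i j (congrFun (congrArg Subtype.val hij) 0)
    simpa using! ENat.card_le_card_of_injective hf

theorem DefinableFamily.definable_le_encard {X : (α → M) → Set (Fin 1 → M)}
    (hX : DefinableFamily L A X) (n : ℕ) : A.Definable L {v | (n : ℕ∞) ≤ (X v).encard} := by
  simp only [le_encard_iff]
  refine definable_exists_tuple (definable_and ?_ ?_)
  · exact definable_forall_index fun i => definable_forall_index fun j =>
      definable_imp (definable_coord_eq (Sum.inr i) (Sum.inr j)) (definable_const _)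
  · exact definable_forall_index fun i => hX.mem (fun _ => Sum.inr i) Sum.inl

theorem DefinableFamily.definable_encard_eq {X : (α → M) → Set (Fin 1 → M)}
    (hX : DefinableFamily L A X) (n : ℕ) : A.Definable L {v | (X v).encard = n} := by
  have h : ∀ e : ℕ∞, e = n ↔ n ≤ e ∧ ¬ ((n + 1 : ℕ) : ℕ∞) ≤ e := by
    intro e
    rw [not_le, Nat.cast_add, Nat.cast_one, ENat.lt_add_one_iff (ENat.natCast_ne_top n),
      le_antisymm_iff, and_comm]
  simp only [h]
  exact definable_and (hX.definable_le_encard n) (definable_not (hX.definable_le_encard (n + 1)))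

end Families

variable {k : Type*} [Field k]

/-- The number of elements of a finite set, and `-(c + 1)` if the set is infinite and `c` is the
number of elements of its complement. -/
noncomputable def numerosity (X : Set (Fin 1 → k)) : k :=
  open Classical in if X.Finite then (X.ncard : k) else -((Xᶜ.ncard : k) + 1)

theorem numerosity_of_finite {X : Set (Fin 1 → k)} (hX : X.Finite) :
    numerosity X = (X.ncard : k) :=
  if_pos hX

theorem numerosity_of_finite_compl [Infinite k] {X : Set (Fin 1 → k)} (hX : Xᶜ.Finite) :
    numerosity X = -((Xᶜ.ncard : k) + 1) :=
  if_neg fun h => infinite_univ (union_compl_self X ▸ h.union hX)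

variable [IsAlgClosed k] [FirstOrder.Ring.CompatibleRing k] {A : Set k} {α : Type*} [Finite α]

/-- By strong minimality, the definable conditions "the set or its complement has fewer than n
elements" cover the parameter space as n varies. A finite subcover gives the bound. -/
theorem Saturated.exists_encard_bound (hk : Saturated ring k) (hA : A.Finite)
    {X : (α → k) → Set (Fin 1 → k)} (hX : DefinableFamily ring A X) :
    ∃ N : ℕ, ∀ v, (X v).encard < N ∨ (X v)ᶜ.encard < N := by
  have := IsAlgClosed.instInfinite (K := k)
  let S : ℕ → Set (α → k) := fun n =>
    {v | ¬ (n : ℕ∞) ≤ (X v).encard ∨ ¬ (n : ℕ∞) ≤ (X v)ᶜ.encard}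
  obtain ⟨D, hDC, hDf, hD⟩ := hk.exists_finite_subcover hA (C := range S)
    (by
      rintro _ ⟨n, rfl⟩
      exact definable_or (definable_not (hX.definable_le_encard n))
        (definable_not (hX.compl.definable_le_encard n)))
    (by
      have hlt : ∀ {Z : Set (Fin 1 → k)}, Z.Finite → ¬ ((Z.ncard + 1 : ℕ) : ℕ∞) ≤ Z.encard := by
        intro Z hZ
        rw [← hZ.cast_ncard_eq, Nat.cast_le]
        omega
      refine eq_univ_of_forall fun v => ?_
      rcases hk.finite_or_finite_compl (hX.fiber v) with h | h
      · exact ⟨_, ⟨_, rfl⟩, Or.inl (hlt h)⟩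
      · exact ⟨_, ⟨_, rfl⟩, Or.inr (hlt h)⟩)
  have hDS : ∀ d ∈ D, ∃ n, S n = d := fun d hd => hDC hd
  choose! n hn using hDS
  obtain ⟨N, hN⟩ := (hDf.image n).bddAbove
  refine ⟨N, fun v => ?_⟩
  obtain ⟨d, hd, hvd⟩ := (hD ▸ mem_univ v : v ∈ ⋃₀ D)
  have hle : (n d : ℕ∞) ≤ N := Nat.cast_le.2 (hN ⟨d, hd, rfl⟩)
  rw [← hn d hd] at hvd
  exact hvd.imp (fun h => (not_le.1 h).trans_le hle) (fun h => (not_le.1 h).trans_le hle)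

/-- Under a uniform bound only finitely many values occur. Each is an integer, hence definable over
`A`, and is attained on a definable condition, so the graph is a finite disjunction. -/
theorem Saturated.definable_numerosity (hk : Saturated ring k) (hA : A.Finite)
    {X : (α → k) → Set (Fin 1 → k)} (hX : DefinableFamily ring A X) :
    A.Definable ring {w : α ⊕ Fin 1 → k | numerosity (X (w ∘ Sum.inl)) = w (Sum.inr 0)} := by
  have := IsAlgClosed.instInfinite (K := k)
  obtain ⟨N, hN⟩ := hk.exists_encard_bound hA hX
  have h : ∀ w : α ⊕ Fin 1 → k, numerosity (X (w ∘ Sum.inl)) = w (Sum.inr 0) ↔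
      (∃ j : Fin N, (X (w ∘ Sum.inl)).encard = (j : ℕ) ∧ w (Sum.inr 0) = ((j : ℕ) : k)) ∨
      ∃ j : Fin N, (X (w ∘ Sum.inl))ᶜ.encard = (j : ℕ) ∧
        w (Sum.inr 0) = -(((j : ℕ) : k) + 1) := by
    intro w
    constructor
    · intro hw
      rcases hN (w ∘ Sum.inl) with h | h
      · have hf := finite_of_encard_le_coe h.le
        rw [← hf.cast_ncard_eq, Nat.cast_lt] at h
        exact Or.inl ⟨⟨_, h⟩, hf.cast_ncard_eq.symm, hw ▸ numerosity_of_finite hf⟩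
      · have hf := finite_of_encard_le_coe h.le
        rw [← hf.cast_ncard_eq, Nat.cast_lt] at h
        exact Or.inr ⟨⟨_, h⟩, hf.cast_ncard_eq.symm, hw ▸ numerosity_of_finite_compl hf⟩
    · rintro (⟨j, hj, hw⟩ | ⟨j, hj, hw⟩)
      · have hf := finite_of_encard_eq_coe hj
        rw [← hf.cast_ncard_eq, Nat.cast_inj] at hj
        rw [hw, numerosity_of_finite hf, hj]
      · have hf := finite_of_encard_eq_coe hj
        rw [← hf.cast_ncard_eq, Nat.cast_inj] at hj
        rw [hw, numerosity_of_finite_compl hf, hj]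
  simp only [h]
  refine definable_or (definable_exists_index fun j => definable_and ?_ ?_)
    (definable_exists_index fun j => definable_and ?_ ?_)
  · exact (hX.comp Sum.inl).definable_encard_eq j
  · exact FirstOrder.Ring.definable_eq_of_mem_closure _ (natCast_mem _ _)
  · exact (hX.compl.comp Sum.inl).definable_encard_eq j
  · exact FirstOrder.Ring.definable_eq_of_mem_closure _
      (neg_mem (add_mem (natCast_mem _ _) (one_mem _)))

theorem Saturated.uniformlyDefinable_numerosity (hk : Saturated ring k) :
    UniformlyDefinable ring k fun X => numerosity X.1 := by
  intro m θ
  have hX : DefinableFamily ring (∅ : Set k)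
      fun a : Fin (m + 1) → k => {x : Fin 1 → k | θ.Realize (Sum.elim x a)} := by
    refine empty_definable_iff.2 ⟨θ, ?_⟩
    ext w
    simp
  have h := definable_comp (Sum.elim Sum.inr Sum.inl : _ → Fin 1 ⊕ Fin (m + 1))
    (hk.definable_numerosity finite_empty hX)
  obtain ⟨θ', hθ'⟩ := empty_definable_iff.1 h
  exact ⟨θ', fun a b => (Set.ext_iff.1 hθ' (Sum.elim ![b] a) : _)⟩

end ModelTheoretic

/-! ### Bijections between finite or cofinite sets -/

namespace Set

variable {k : Type*}

theorem exists_bijOn_of_finite {X Y : Set k} (hX : X.Finite) (hY : Y.Finite)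
    (h : X.ncard = Y.ncard) : ∃ g : k → k, BijOn g X Y := by
  rcases isEmpty_or_nonempty k with hk | hk
  · exact ⟨id, by simp [Set.eq_empty_of_isEmpty]⟩
  · exact hX.exists_bijOn_of_encard_eq (by rw [← hX.cast_ncard_eq, ← hY.cast_ncard_eq, h])

/-- Cofinite sets whose complements have the same number of elements are in bijection, via a
function that moves only finitely many elements. -/
theorem exists_bijOn_of_finite_compl {X Y : Set k} (hX : Xᶜ.Finite) (hY : Yᶜ.Finite)
    (h : Xᶜ.ncard = Yᶜ.ncard) : ∃ g : k → k, BijOn g X Y ∧ {x ∈ X | g x ≠ x}.Finite := by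
  classical
  have hXY : (X \ Y).Finite := hY.subset fun x hx => hx.2
  have hYX : (Y \ X).Finite := hX.subset fun x hx => hx.2
  -- `X \ Y` and `Y \ X` are what remains of the two complements after removing their common part.
  -- The bijection is then the identity on `X ∩ Y` and some `f : X \ Y → Y \ X` elsewhere.
  have hcard : (X \ Y).ncard = (Y \ X).ncard := by
    have h1 := ncard_inter_add_ncard_sdiff_eq_ncard Xᶜ Yᶜ hX
    have h2 := ncard_inter_add_ncard_sdiff_eq_ncard Yᶜ Xᶜ hY
    rw [compl_sdiff_compl] at h1 h2
    rw [inter_comm] at h2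
    omega
  obtain ⟨f, hf⟩ := exists_bijOn_of_finite hXY hYX hcard
  let g : k → k := fun x => if x ∈ Y then x else f x
  have h1 : BijOn g (X ∩ Y) (X ∩ Y) :=
    (bijOn_id _).congr fun x hx => (if_pos hx.2).symm
  have h2 : BijOn g (X \ Y) (Y \ X) := hf.congr fun x hx => (if_neg hx.2).symm
  refine ⟨g, ?_, hXY.subset fun x hx => ⟨hx.1, fun hxY => hx.2 (if_pos hxY)⟩⟩
  have h3 := h1.union h2 ?_
  · rwa [inter_union_sdiff, inter_comm X Y, inter_union_sdiff] at h3
  · rw [inter_union_sdiff]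
    intro x hx y hy hxy
    by_cases hxY : x ∈ Y <;> by_cases hyY : y ∈ Y
    · simpa [g, hxY, hyY] using hxy
    · have := h2.mapsTo ⟨hy, hyY⟩
      rw [← hxy] at this
      exact absurd (by simpa [g, hxY] using hx) this.2
    · have := h2.mapsTo ⟨hx, hxY⟩
      rw [hxy] at this
      exact absurd (by simpa [g, hyY] using hy) this.2
    · exact h2.injOn ⟨hx, hxY⟩ ⟨hy, hyY⟩ hxy

end Set

/-! ### Hume's Principle for definable bijections -/

namespace ModelTheoretic

open Set FirstOrder.Language

/-- The binary relation `G` is the graph of a bijection from `X` to `Y`. -/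
structure IsBijectionGraph {M : Type*} (G : Set (Fin 2 → M)) (X Y : Set (Fin 1 → M)) : Prop where
  mem : ∀ x y, ![x, y] ∈ G → ![x] ∈ X ∧ ![y] ∈ Y
  total : ∀ x, ![x] ∈ X → ∃ y, ![x, y] ∈ G
  functional : ∀ x y z, ![x, y] ∈ G ∧ ![x, z] ∈ G → y = z
  injective : ∀ x y z, ![x, z] ∈ G ∧ ![y, z] ∈ G → x = y
  surjective : ∀ y, ![y] ∈ Y → ∃ x, ![x, y] ∈ G

namespace IsBijectionGraph

variable {M : Type*} {G : Set (Fin 2 → M)} {X Y : Set (Fin 1 → M)}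

theorem exists_bijOn (h : IsBijectionGraph G X Y) : ∃ g : M → M,
    BijOn g {x | ![x] ∈ X} {y | ![y] ∈ Y} ∧ ∀ x, ![x] ∈ X → ∀ y, ![x, y] ∈ G ↔ g x = y := by
  classical
  let g : M → M := fun x => if hx : ![x] ∈ X then (h.total x hx).choose else x
  have hg : ∀ x, ![x] ∈ X → ∀ y, ![x, y] ∈ G ↔ g x = y := by
    intro x hx y
    have hspec : ![x, g x] ∈ G := by
      simp only [g, dif_pos hx]
      exact (h.total x hx).choose_spec
    exact ⟨fun hxy => h.functional x _ _ ⟨hspec, hxy⟩, fun hxy => hxy ▸ hspec⟩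
  refine ⟨g, ⟨fun x hx => (h.mem x _ ((hg x hx _).2 rfl)).2, fun x hx y hy hxy => ?_,
    fun y hy => ?_⟩, hg⟩
  · exact h.injective x y _ ⟨(hg x hx _).2 rfl, (hg y hy _).2 hxy.symm⟩
  · obtain ⟨x, hx⟩ := h.surjective y hy
    exact ⟨x, (h.mem x y hx).1, (hg x (h.mem x y hx).1 y).1 hx⟩

theorem of_bijOn {g : M → M} (hg : BijOn g {x | ![x] ∈ X} {y | ![y] ∈ Y}) :
    IsBijectionGraph {v : Fin 2 → M | ![v 0] ∈ X ∧ g (v 0) = v 1} X Y where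
  mem := by
    rintro x y ⟨hx, hxy⟩
    obtain rfl : g x = y := hxy
    exact ⟨hx, hg.mapsTo hx⟩
  total x hx := ⟨g x, hx, rfl⟩
  functional x y z h := h.1.2.symm.trans h.2.2
  injective x y z h := hg.injOn h.1.1 h.2.1 (h.1.2.trans h.2.2.symm)
  surjective y hy := by
    obtain ⟨x, hx, hxy⟩ := hg.surjOn hy
    exact ⟨x, hx, hxy⟩

theorem symm (h : IsBijectionGraph G X Y) :
    IsBijectionGraph {v : Fin 2 → M | ![v 1, v 0] ∈ G} Y X where
  mem x y hxy := (h.mem y x hxy).symm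
  total := h.surjective
  functional x y z hxyz := h.injective y z x hxyz
  injective x y z hxyz := h.functional z x y hxyz
  surjective := h.total

end IsBijectionGraph

theorem vec_one_eq {M : Type*} (v : Fin 1 → M) : ![v 0] = v := by
  ext i
  rw [Subsingleton.elim i 0]
  rfl

theorem finite_setOf_vec {M : Type*} {X : Set (Fin 1 → M)} :
    {x : M | ![x] ∈ X}.Finite ↔ X.Finite := by
  have h : {x : M | ![x] ∈ X} = (Equiv.funUnique (Fin 1) M).symm ⁻¹' X := by
    ext x
    rw [mem_preimage, ← vec_one_eq ((Equiv.funUnique (Fin 1) M).symm x)]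
    rfl
  rw [h, ← Equiv.image_eq_preimage_symm]
  exact finite_image_iff (Equiv.funUnique (Fin 1) M).injective.injOn

theorem ncard_setOf_vec {M : Type*} (X : Set (Fin 1 → M)) :
    {x : M | ![x] ∈ X}.ncard = X.ncard := by
  have h : {x : M | ![x] ∈ X} = (Equiv.funUnique (Fin 1) M).symm ⁻¹' X := by
    ext x
    rw [mem_preimage, ← vec_one_eq ((Equiv.funUnique (Fin 1) M).symm x)]
    rfl
  rw [h, ← Equiv.image_eq_preimage_symm]
  exact ncard_image_of_injective _ (Equiv.funUnique (Fin 1) M).injective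

/-- The moved points and their images serve as parameters; on the rest of `X` the graph is the
diagonal. -/
theorem definable_graph_of_finite_moved {L : FirstOrder.Language} {M : Type*} [L.Structure M]
    {X : Set (Fin 1 → M)} (hX : (univ : Set M).Definable L X) {g : M → M}
    (hg : {x ∈ {x | ![x] ∈ X} | g x ≠ x}.Finite) :
    (univ : Set M).Definable L {v : Fin 2 → M | ![v 0] ∈ X ∧ g (v 0) = v 1} := by
  have hX' : (univ : Set M).Definable L {v : Fin 2 → M | ![v 0] ∈ X} := by
    have := definable_comp (fun _ => 0 : Fin 1 → Fin 2) hX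
    convert this using 1
    ext v
    rw [mem_ofPred_eq, mem_ofPred_eq, ← vec_one_eq (v ∘ fun _ => 0)]
    rfl
  have := hg.to_subtype
  have h : (univ : Set M).Definable L {v : Fin 2 → M |
      (∃ x : {x ∈ {x | ![x] ∈ X} | g x ≠ x}, v 0 = x ∧ v 1 = g x) ∨
      ((∀ x : {x ∈ {x | ![x] ∈ X} | g x ≠ x}, ¬ v 0 = x) ∧ ![v 0] ∈ X ∧ v 0 = v 1)} :=
    definable_or
      (definable_exists_index fun x => definable_and (definable_coord_eq_const 0 (mem_univ _))
        (definable_coord_eq_const 1 (mem_univ _)))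
      (definable_and (definable_forall_index fun x => definable_not
        (definable_coord_eq_const 0 (mem_univ _))) (definable_and hX' (definable_coord_eq 0 1)))
  convert h using 1
  ext v
  constructor
  · rintro ⟨hv, hgv⟩
    by_cases hm : g (v 0) = v 0
    · refine Or.inr ⟨fun x hx => x.2.2 ?_, hv, hm ▸ hgv⟩
      rw [← hx, hm]
    · exact Or.inl ⟨⟨v 0, hv, hm⟩, rfl, hgv.symm⟩
  · rintro (⟨x, h0, h1⟩ | ⟨hx, hv, h01⟩)
    · exact ⟨h0 ▸ x.2.1, h0 ▸ h1.symm⟩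
    · refine ⟨hv, ?_⟩
      by_contra hm
      exact hx ⟨v 0, hv, fun h => hm (h.trans h01)⟩ rfl

section

variable {k : Type*} [Field k] [IsAlgClosed k] [CharZero k] [FirstOrder.Ring.CompatibleRing k]
  {X Y : Set (Fin 1 → k)} {G : Set (Fin 2 → k)}

/-- Glue the bijection to an injection `e` of complements, which exists by `hle`. The result `F` is
a definable injection `k → k`, so it is onto by Ax-Grothendieck. Points outside `Y` can only come
from `e`. -/
theorem IsBijectionGraph.ncard_compl_le (h : IsBijectionGraph G X Y)
    (hG : (univ : Set k).Definable ring G) (hX : Xᶜ.Finite) (hY : Yᶜ.Finite)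
    (hle : Xᶜ.ncard ≤ Yᶜ.ncard) : Yᶜ.ncard ≤ Xᶜ.ncard := by
  classical
  obtain ⟨g, hg, hgG⟩ := h.exists_bijOn
  let X' : Set k := {x | ![x] ∈ X}
  let Y' : Set k := {y | ![y] ∈ Y}
  have hX' : X'ᶜ.Finite := finite_setOf_vec.2 hX
  have hY' : Y'ᶜ.Finite := finite_setOf_vec.2 hY
  have hXc : X'ᶜ.ncard = Xᶜ.ncard := ncard_setOf_vec Xᶜ
  have hYc : Y'ᶜ.ncard = Yᶜ.ncard := ncard_setOf_vec Yᶜ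
  obtain ⟨e, heY, he⟩ := hX'.exists_injOn_of_encard_le (t := Y'ᶜ)
    (by rw [← hX'.cast_ncard_eq, ← hY'.cast_ncard_eq, hXc, hYc]; exact Nat.cast_le.2 hle)
  let F : k → k := fun x => if x ∈ X' then g x else e x
  have hFX : ∀ {x}, x ∈ X' → F x = g x := fun hx => if_pos hx
  have hFXc : ∀ {x}, x ∉ X' → F x = e x := fun hx => if_neg hx
  have hinj : Function.Injective F := by
    intro x y hxy
    by_cases hx : x ∈ X' <;> by_cases hy : y ∈ X'
    · rw [hFX hx, hFX hy] at hxy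
      exact hg.injOn hx hy hxy
    · rw [hFX hx, hFXc hy] at hxy
      exact absurd (hg.mapsTo hx) (hxy ▸ heY hy)
    · rw [hFXc hx, hFX hy] at hxy
      exact absurd (hg.mapsTo hy) (hxy ▸ heY hx)
    · rw [hFXc hx, hFXc hy] at hxy
      exact he hx hy hxy
  have hdef : (univ : Set k).Definable ring {v : Fin 2 → k | F (v 0) = v 1} := by
    have := hX'.to_subtype
    have h1 : (univ : Set k).Definable ring {v : Fin 2 → k |
        v ∈ G ∨ ∃ x : (X'ᶜ : Set k), v 0 = x ∧ v 1 = e x} :=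
      definable_or hG (definable_exists_index fun x =>
        definable_and (definable_coord_eq_const 0 (mem_univ _))
          (definable_coord_eq_const 1 (mem_univ _)))
    convert h1 using 1
    ext v
    have hv : v = ![v 0, v 1] := by ext i; fin_cases i <;> rfl
    rw [mem_ofPred_eq, mem_ofPred_eq]
    by_cases hx : v 0 ∈ X'
    · rw [hFX hx, ← hgG _ hx, ← hv]
      refine ⟨Or.inl, ?_⟩
      rintro (h | ⟨x, h0, -⟩)
      · exact h
      · exact absurd (h0 ▸ hx) x.2
    · rw [hFXc hx]
      constructor
      · exact fun h => Or.inr ⟨⟨v 0, hx⟩, rfl, h.symm⟩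
      · rintro (h' | ⟨x, h0, h1⟩)
        · rw [hv] at h'
          exact absurd (h.mem _ _ h').1 hx
        · rw [h0, h1]
  have hsurj := FirstOrder.Ring.surjective_of_injective_of_definable hdef hinj
  rw [← hXc, ← hYc]
  refine (ncard_le_ncard (fun y hy => ?_) (hX'.image e)).trans (ncard_image_le hX')
  obtain ⟨x, rfl⟩ := hsurj y
  by_cases hx : x ∈ X'
  · exact absurd (hFX hx ▸ hg.mapsTo hx) hy
  · exact ⟨x, hx, (hFXc hx).symm⟩

theorem IsBijectionGraph.finite_iff {M : Type*} {X Y : Set (Fin 1 → M)} {G : Set (Fin 2 → M)}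
    (h : IsBijectionGraph G X Y) : X.Finite ↔ Y.Finite := by
  obtain ⟨g, hg, -⟩ := h.exists_bijOn
  rw [← finite_setOf_vec (X := X), ← finite_setOf_vec (X := Y)]
  exact hg.finite_iff_finite

theorem IsBijectionGraph.ncard_eq {M : Type*} {X Y : Set (Fin 1 → M)} {G : Set (Fin 2 → M)}
    (h : IsBijectionGraph G X Y) : X.ncard = Y.ncard := by
  obtain ⟨g, hg, -⟩ := h.exists_bijOn
  rw [← ncard_setOf_vec X, ← ncard_setOf_vec Y, ← hg.image_eq, hg.injOn.ncard_image]

/-- Hume's Principle for `numerosity`. -/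
theorem Saturated.numerosity_eq_iff (hk : Saturated ring k)
    (hX : (univ : Set k).Definable ring X) (hY : (univ : Set k).Definable ring Y) :
    numerosity X = numerosity Y ↔
      ∃ G : Set (Fin 2 → k), (univ : Set k).Definable ring G ∧ IsBijectionGraph G X Y := by
  have := IsAlgClosed.instInfinite (K := k)
  constructor
  · intro h
    suffices ∃ g : k → k, BijOn g {x | ![x] ∈ X} {y | ![y] ∈ Y} ∧
        {x ∈ {x | ![x] ∈ X} | g x ≠ x}.Finite by
      obtain ⟨g, hg, hgf⟩ := this
      exact ⟨_, definable_graph_of_finite_moved hX hgf, .of_bijOn hg⟩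
    -- Characteristic zero separates the values at finite sets from those at cofinite sets; the
    -- shift by one keeps the empty set apart from `k`.
    have hcast : ∀ m n : ℕ, (m : k) ≠ -((n : k) + 1) := by
      intro m n hmn
      have : ((m + n + 1 : ℕ) : k) = 0 := by
        push_cast
        rw [hmn]
        ring
      exact absurd (Nat.cast_eq_zero.1 this) (by omega)
    rcases hk.finite_or_finite_compl hX with hXf | hXf <;>
      rcases hk.finite_or_finite_compl hY with hYf | hYf
    · rw [numerosity_of_finite hXf, numerosity_of_finite hYf, Nat.cast_inj] at h
      obtain ⟨g, hg⟩ := exists_bijOn_of_finite (finite_setOf_vec.2 hXf) (finite_setOf_vec.2 hYf)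
        (by rw [ncard_setOf_vec, ncard_setOf_vec, h])
      exact ⟨g, hg, (finite_setOf_vec.2 hXf).subset fun x hx => hx.1⟩
    · rw [numerosity_of_finite hXf, numerosity_of_finite_compl hYf] at h
      exact absurd h (hcast _ _)
    · rw [numerosity_of_finite_compl hXf, numerosity_of_finite hYf] at h
      exact absurd h.symm (hcast _ _)
    · rw [numerosity_of_finite_compl hXf, numerosity_of_finite_compl hYf, neg_inj, add_left_inj,
        Nat.cast_inj] at h
      exact exists_bijOn_of_finite_compl (finite_setOf_vec (X := Xᶜ).2 hXf)
        (finite_setOf_vec (X := Yᶜ).2 hYf)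
        ((ncard_setOf_vec Xᶜ).trans (h.trans (ncard_setOf_vec Yᶜ).symm))
  · rintro ⟨G, hG, h⟩
    by_cases hXf : X.Finite
    · rw [numerosity_of_finite hXf, numerosity_of_finite (h.finite_iff.1 hXf), h.ncard_eq]
    · have hXc := (hk.finite_or_finite_compl hX).resolve_left hXf
      have hYc := (hk.finite_or_finite_compl hY).resolve_left fun hYf => hXf (h.finite_iff.2 hYf)
      have hG' : (univ : Set k).Definable ring {v : Fin 2 → k | ![v 1, v 0] ∈ G} := by
        have hswap : {v : Fin 2 → k | ![v 1, v 0] ∈ G} = (fun v => v ∘ ![1, 0]) ⁻¹' G := by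
          ext v
          refine iff_of_eq (congrArg (· ∈ G) ?_)
          ext i
          fin_cases i <;> rfl
        exact hswap ▸ hG.preimage_comp _
      have : Xᶜ.ncard = Yᶜ.ncard := by
        rcases le_total Xᶜ.ncard Yᶜ.ncard with hle | hle
        · exact le_antisymm hle (h.ncard_compl_le hG hXc hYc hle)
        · exact le_antisymm (h.symm.ncard_compl_le hG' hYc hXc hle) hle
      rw [numerosity_of_finite_compl hXc, numerosity_of_finite_compl hYc, this]

end

end ModelTheoretic

/-! ### Satisfaction of second-order formulas -/

namespace SecondOrder

open Set ModelTheoretic FirstOrder.Language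

section Satisfaction

variable {M : Type*} {N : Struct M}

namespace Assignment

theorem ext {s t : Assignment N} (h : s.obj = t.obj) (h' : ∀ n R, s.rel n R = t.rel n R) :
    s = t := by
  obtain ⟨so, sr⟩ := s
  obtain ⟨uo, tr⟩ := t
  obtain rfl : so = uo := h
  obtain rfl : sr = tr := funext fun n => funext fun R => h' n R
  rfl

/-- Give the variables `x i` the values `v i`. -/
noncomputable def updateObjs {n : ℕ} (s : Assignment N) (x : Fin n → ℕ) (v : Fin n → M) :
    Assignment N where
  obj := Function.extend x v s.obj
  rel := s.rel

theorem updateRel_rel_self (s : Assignment N) (n R : ℕ) (B : N.rel n) :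
    (s.updateRel n R B).rel n R = B := by
  simp [updateRel]

theorem updateRel_rel_of_ne (s : Assignment N) {n R m S : ℕ} (B : N.rel n)
    (h : ¬ (n = m ∧ R = S)) : (s.updateRel n R B).rel m S = s.rel m S := by
  by_cases hm : n = m
  · subst hm
    have : S ≠ R := fun hS => h ⟨rfl, hS.symm⟩
    simp [updateRel, this]
  · simp [updateRel, Function.update_of_ne (Ne.symm hm)]

end Assignment

namespace Formula

@[simp]
theorem sat_and (φ ψ : Formula) (s : Assignment N) :
    (φ.and ψ).Sat s ↔ φ.Sat s ∧ ψ.Sat s := by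
  change ¬ (φ.Sat s → ¬ ψ.Sat s) ↔ _
  tauto

@[simp]
theorem sat_iff (φ ψ : Formula) (s : Assignment N) :
    (φ.iff ψ).Sat s ↔ (φ.Sat s ↔ ψ.Sat s) :=
  (sat_and (φ.imp ψ) (ψ.imp φ) s).trans iff_iff_implies_and_implies.symm

theorem sat_memVars {n : ℕ} (x : Fin (n + 1) → ℕ) (R : ℕ) (s : Assignment N) :
    (memVars x R).Sat s ↔ s.obj ∘ x ∈ (s.rel n R).1 :=
  Iff.rfl

theorem sat_allObjs {n : ℕ} {x : Fin n → ℕ} (hx : Function.Injective x) (φ : Formula)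
    (s : Assignment N) : (allObjs x φ).Sat s ↔ ∀ v, φ.Sat (s.updateObjs x v) := by
  induction n generalizing s with
  | zero =>
    have h : ∀ v, s.updateObjs x v = s := fun v => Assignment.ext
      (funext fun y => Function.extend_apply' _ _ _ fun ⟨i, _⟩ => i.elim0) fun _ _ => rfl
    simp [allObjs, h]
  | succ n ih =>
    have htail : Function.Injective fun i : Fin n => x i.succ :=
      hx.comp (Fin.succ_injective n)
    have h : ∀ a v, (s.updateObj (x 0) a).updateObjs (fun i : Fin n => x i.succ) v =
        s.updateObjs x (Fin.cons a v) := by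
      intro a v
      refine Assignment.ext (funext fun y => ?_) fun _ _ => rfl
      change Function.extend (fun i : Fin n => x i.succ) v (Function.update s.obj (x 0) a) y =
        Function.extend x (Fin.cons a v) s.obj y
      by_cases hy : ∃ i, x i = y
      · obtain ⟨i, rfl⟩ := hy
        rw [hx.extend_apply]
        induction i using Fin.cases with
        | zero =>
          rw [Function.extend_apply' _ _ _ fun ⟨i, hi⟩ => Fin.succ_ne_zero i (hx hi)]
          simp
        | succ i => exact htail.extend_apply _ _ i
      · rw [Function.extend_apply' _ _ _ hy, Function.extend_apply' _ _ _ fun ⟨i, hi⟩ => hy ⟨_, hi⟩,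
          Function.update_of_ne fun h0 => hy ⟨0, h0.symm⟩]
    have hsucc : allObjs x φ = (allObjs (fun i : Fin n => x i.succ) φ).allObj (x 0) := by
      simp [allObjs, List.ofFn_succ]
    rw [hsucc]
    change (∀ a, (allObjs (fun i : Fin n => x i.succ) φ).Sat (s.updateObj (x 0) a)) ↔ _
    simp only [ih htail, h]
    exact ⟨fun H v => Fin.cons_self_tail v ▸ H _ _, fun H a v => H _⟩

theorem sat_congr (φ : Formula) {s t : Assignment N} (hobj : s.obj = t.obj)
    (hrel : ∀ n R, φ.RelFree n R → s.rel n R = t.rel n R) : φ.Sat s ↔ φ.Sat t := by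
  have hterm : ∀ (u : Term) {s t : Assignment N}, s.obj = t.obj →
      (∀ R, u.HasSetVar R → s.rel 0 R = t.rel 0 R) → u.eval s = u.eval t := by
    rintro (x | X) s t hobj hrel
    · exact congrFun hobj x
    · exact congrArg N.num (hrel X rfl)
  induction φ generalizing s t with
  | falsum => rfl
  | eq u v =>
    simp only [Sat]
    rw [hterm u hobj fun R h => hrel 0 R ⟨rfl, Or.inl h⟩,
      hterm v hobj fun R h => hrel 0 R ⟨rfl, Or.inr h⟩]
  | relEq n R S =>
    simp only [Sat]
    rw [hrel n R ⟨rfl, Or.inl rfl⟩, hrel n S ⟨rfl, Or.inr rfl⟩]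
  | mem n u R =>
    simp only [Sat]
    rw [hrel n R (Or.inl ⟨rfl, rfl⟩), funext fun i =>
      hterm (u i) hobj fun R h => hrel 0 R (Or.inr ⟨rfl, i, h⟩)]
  | imp φ ψ hφ hψ =>
    exact imp_congr (hφ hobj fun n R h => hrel n R (Or.inl h))
      (hψ hobj fun n R h => hrel n R (Or.inr h))
  | allObj x φ ih =>
    exact forall_congr' fun a => ih 
      (show Function.update s.obj x a = Function.update t.obj x a by rw [hobj]) hrel
  | exObj x φ ih =>
    exact exists_congr fun a => ih 
      (show Function.update s.obj x a = Function.update t.obj x a by rw [hobj]) hrel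
  | allRel m S φ ih =>
    refine forall_congr' fun B => ih hobj fun n R h => ?_
    by_cases hS : m = n ∧ S = R
    · obtain ⟨rfl, rfl⟩ := hS
      rw [Assignment.updateRel_rel_self, Assignment.updateRel_rel_self]
    · rw [Assignment.updateRel_rel_of_ne _ _ hS, Assignment.updateRel_rel_of_ne _ _ hS]
      exact hrel n R ⟨hS, h⟩
  | exRel m S φ ih =>
    refine exists_congr fun B => ih hobj fun n R h => ?_
    by_cases hS : m = n ∧ S = R
    · obtain ⟨rfl, rfl⟩ := hS
      rw [Assignment.updateRel_rel_self, Assignment.updateRel_rel_self]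
    · rw [Assignment.updateRel_rel_of_ne _ _ hS, Assignment.updateRel_rel_of_ne _ _ hS]
      exact hrel n R ⟨hS, h⟩

theorem sat_updateRel_of_not_relFree {φ : Formula} {n R : ℕ} (h : ¬ φ.RelFree n R)
    (s : Assignment N) (B : N.rel n) : φ.Sat (s.updateRel n R B) ↔ φ.Sat s := by
  refine φ.sat_congr rfl fun m S hS => Assignment.updateRel_rel_of_ne _ _ ?_
  rintro ⟨rfl, rfl⟩
  exact h hS

/-- Reduces every comprehension instance to membership of the extension of φ in the sort of `R`. -/
theorem sat_comprehension {n : ℕ} {x : Fin (n + 1) → ℕ} (hx : Function.Injective x) {R : ℕ}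
    {φ : Formula} (hφ : ¬ φ.RelFree n R) (s : Assignment N) :
    (comprehension x R φ).Sat s ↔
      {v | φ.Sat (s.updateObjs x v)} ∈ N.rel n := by
  have h : ∀ B : N.rel n, (allObjs x ((memVars x R).iff φ)).Sat (s.updateRel n R B) ↔
      B.1 = {v | φ.Sat (s.updateObjs x v)} := by
    intro B
    rw [sat_allObjs hx, Set.ext_iff]
    refine forall_congr' fun v => ?_
    have hv : ((s.updateRel n R B).updateObjs x v) = (s.updateObjs x v).updateRel n R B := rfl
    rw [sat_iff, hv, sat_updateRel_of_not_relFree hφ, sat_memVars,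
      Assignment.updateRel_rel_self]
    have hx' : ((s.updateObjs x v).updateRel n R B).obj ∘ x = v :=
      funext fun i => hx.extend_apply _ _ i
    rw [hx']
    rfl
  exact ⟨fun ⟨B, hB⟩ => (h B).1 hB ▸ B.2, fun hB => ⟨⟨_, hB⟩, (h ⟨_, hB⟩).2 rfl⟩⟩

end Formula

/-! ### A bound for the variables of a formula -/

def Term.Below (b : ℕ) : Term → Prop
  | .obj x => x < b
  | .num X => X < b

/-- All the free variables of the formula, and the arities of the relation variables, are less
than `b`. -/
def Formula.Below (b : ℕ) : Formula → Prop
  | .falsum => True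
  | .eq t u => t.Below b ∧ u.Below b
  | .relEq n R S => n < b ∧ R < b ∧ S < b
  | .mem n t R => n < b ∧ R < b ∧ ∀ i, (t i).Below b
  | .imp φ ψ => φ.Below b ∧ ψ.Below b
  | .allObj _ φ => φ.Below b
  | .exObj _ φ => φ.Below b
  | .allRel _ _ φ => φ.Below b
  | .exRel _ _ φ => φ.Below b

theorem Term.Below.mono {b c : ℕ} (h : b ≤ c) {t : Term} (ht : t.Below b) : t.Below c := by
  cases t <;> exact lt_of_lt_of_le ht h

theorem Formula.Below.mono {b c : ℕ} (h : b ≤ c) {φ : Formula} (hφ : φ.Below b) : φ.Below c := by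
  induction φ with
  | falsum => trivial
  | eq t u => exact ⟨hφ.1.mono h, hφ.2.mono h⟩
  | relEq n R S => exact ⟨hφ.1.trans_le h, hφ.2.1.trans_le h, hφ.2.2.trans_le h⟩
  | mem n t R => exact ⟨hφ.1.trans_le h, hφ.2.1.trans_le h, fun i => (hφ.2.2 i).mono h⟩
  | imp φ ψ ih ih' => exact ⟨ih hφ.1, ih' hφ.2⟩
  | allObj x φ ih => exact ih hφ
  | exObj x φ ih => exact ih hφ
  | allRel n R φ ih => exact ih hφ
  | exRel n R φ ih => exact ih hφ

theorem Term.exists_below : ∀ t : Term, ∃ b, t.Below b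
  | .obj x => ⟨x + 1, x.lt_succ_self⟩
  | .num X => ⟨X + 1, X.lt_succ_self⟩

/-- With finitely many variables in play, an assignment needs only finitely many parameters, as
compactness requires. -/
theorem Formula.exists_below (φ : Formula) : ∃ b, φ.Below b := by
  induction φ with
  | falsum => exact ⟨0, trivial⟩
  | eq t u =>
    obtain ⟨b, hb⟩ := t.exists_below
    obtain ⟨c, hc⟩ := u.exists_below
    exact ⟨max b c, hb.mono (le_max_left _ _), hc.mono (le_max_right _ _)⟩
  | relEq n R S => exact ⟨n + R + S + 1, by omega, by omega, by omega⟩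
  | mem n t R =>
    choose b hb using fun i => (t i).exists_below
    refine ⟨n + R + 1 + ∑ i, b i, by omega, by omega, fun i => (hb i).mono ?_⟩
    exact (Finset.single_le_sum (fun _ _ => Nat.zero_le _) (Finset.mem_univ i)).trans
      (Nat.le_add_left _ _)
  | imp φ ψ ih ih' =>
    obtain ⟨b, hb⟩ := ih
    obtain ⟨c, hc⟩ := ih'
    exact ⟨max b c, hb.mono (le_max_left _ _), hc.mono (le_max_right _ _)⟩
  | allObj x φ ih => exact ih
  | exObj x φ ih => exact ih
  | allRel n R φ ih => exact ih
  | exRel n R φ ih => exact ih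

end Satisfaction

/-! ### Definability of satisfaction -/

/-- The structure given by `numerosity`. -/
noncomputable abbrev numerosityStruct (k : Type*) [Field k] [FirstOrder.Ring.CompatibleRing k] :
    Struct k :=
  definableStruct ring k fun X => numerosity X.1

section Definability

variable {k : Type*} [Field k] [FirstOrder.Ring.CompatibleRing k] {A : Set k} {α β : Type}

/-- The values of the variables below `b` in the assignments `s v` are uniformly definable over
`A`. -/
structure DefinableAssignments (A : Set k) (b : ℕ)
    (s : (α → k) → Assignment (numerosityStruct k)) : Prop where
  obj : ∀ x < b, A.Definable ring
    {w : α ⊕ Fin 1 → k | (s (w ∘ Sum.inl)).obj x = w (Sum.inr 0)}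
  rel : ∀ n < b, ∀ R < b, DefinableFamily ring A fun v => ((s v).rel n R).1

namespace DefinableAssignments

variable {b : ℕ} {s : (α → k) → Assignment (numerosityStruct k)}

theorem comp (hs : DefinableAssignments A b s) (f : α → β) :
    DefinableAssignments A b fun v : β → k => s (v ∘ f) where
  obj x hx := definable_comp (Sum.map f id) (hs.obj x hx)
  rel n hn R hR := (hs.rel n hn R hR).comp f

theorem updateObj (hs : DefinableAssignments A b s) (x : ℕ) (i : α) :
    DefinableAssignments A b fun v => (s v).updateObj x (v i) where
  obj y hy := by
    by_cases hxy : y = x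
    · subst hxy
      simpa [Assignment.updateObj] using definable_coord_eq (Sum.inl i) (Sum.inr 0)
    · simpa [Assignment.updateObj, hxy] using hs.obj y hy
  rel := hs.rel

theorem updateRel (hs : DefinableAssignments A b s) (n R : ℕ)
    {X : (α → k) → (numerosityStruct k).rel n}
    (hX : DefinableFamily ring A fun v => (X v).1) :
    DefinableAssignments A b fun v => (s v).updateRel n R (X v) where
  obj := hs.obj
  rel m hm S hS := by
    by_cases h : n = m ∧ R = S
    · obtain ⟨rfl, rfl⟩ := h
      simpa only [Assignment.updateRel_rel_self] using hX
    · simpa only [Assignment.updateRel_rel_of_ne _ _ h] using hs.rel m hm S hS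

variable [IsAlgClosed k] [Finite α]

theorem definable_eval (hk : Saturated ring k) (hA : A.Finite) (hs : DefinableAssignments A b s)
    {t : Term} (ht : t.Below b) :
    A.Definable ring {w : α ⊕ Fin 1 → k | t.eval (s (w ∘ Sum.inl)) = w (Sum.inr 0)} := by
  cases t with
  | obj x => exact hs.obj x ht
  | num X =>
    exact hk.definable_numerosity hA (hs.rel 0 (Nat.zero_lt_of_lt ht) X ht)

/-- Object quantifiers add a coordinate to the family of assignments, while `A` stays fixed. Terms
`#X` are handled by the definability of `numerosity` in families. -/
theorem definable_sat (hk : Saturated ring k) (hA : A.Finite) (hs : DefinableAssignments A b s)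
    {φ : Formula} (hφ : φ.IsArithmetical) (hb : φ.Below b) :
    A.Definable ring {v | φ.Sat (s v)} := by
  induction φ generalizing α with
  | falsum => exact definable_const False
  | eq t u =>
    exact definable_subst (P := fun v c => t.eval (s v) = c) (g := fun v => u.eval (s v))
      (hs.definable_eval hk hA hb.2) (hs.definable_eval hk hA hb.1)
  | relEq n R S =>
    simp only [Formula.Sat, ← Subtype.coe_inj]
    exact (hs.rel n hb.1 R hb.2.1).definable_eq (hs.rel n hb.1 S hb.2.2)
  | mem n t R =>
    -- The terms need not be variables, so their values are named by an auxiliary tuple `u`.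
    have h : A.Definable ring {v : α → k | ∃ u : Fin (n + 1) → k,
        (∀ i, (t i).eval (s v) = u i) ∧ u ∈ ((s v).rel n R).1} :=
      definable_exists_tuple (definable_and
        (definable_forall_index fun i =>
          definable_comp (Sum.map id fun _ => i) (hs.definable_eval hk hA (hb.2.2 i)))
        ((hs.rel n hb.1 R hb.2.1).mem Sum.inr Sum.inl))
    convert h using 1
    ext v
    refine ⟨fun hv => ⟨_, fun _ => rfl, hv⟩, fun ⟨u, hu, huR⟩ => ?_⟩
    rw [← funext hu] at huR
    exact huR
  | imp φ ψ ih ih' => exact definable_imp (ih hs hφ.1 hb.1) (ih' hs hφ.2 hb.2)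
  | allObj x φ ih => exact definable_forall (ih ((hs.comp Sum.inl).updateObj x (Sum.inr 0)) hφ hb)
  | exObj x φ ih => exact definable_exists (ih ((hs.comp Sum.inl).updateObj x (Sum.inr 0)) hφ hb)
  | allRel n R φ ih => exact hφ.elim
  | exRel n R φ ih => exact hφ.elim

end DefinableAssignments

/-- Allows a quantifier over definable relations to be traded for a choice of parameter-free formula
and a quantifier over parameter tuples. -/
theorem exists_fiber_eq {n : ℕ} (B : definableSets ring k n) :
    ∃ (m : ℕ) (θ : ring.Formula (Fin n ⊕ Fin m)) (a : Fin m → k), fiber θ a = B := by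
  obtain ⟨P, -, hP⟩ := definable_iff_finitely_definable.1 B.2
  obtain ⟨θ, hθ⟩ := definable_iff_exists_formula_sum.1 hP
  obtain ⟨m, ⟨e⟩⟩ := Finite.exists_equiv_fin P
  refine ⟨m, θ.relabel (Sum.elim (Sum.inr ∘ e) Sum.inl), fun i => (e.symm i : k),
    Subtype.ext (Eq.trans ?_ hθ.symm)⟩
  ext v
  rw [fiber, mem_ofPred_eq, mem_ofPred_eq, Formula.realize_relabel]
  refine iff_of_eq (congrArg _ ?_)
  funext i
  rcases i with i | i <;> simp

/-- Along uniformly definable assignments, `Q` is a union of definable sets. -/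
def IsUnionOfDefinable (A : Set k) (b : ℕ) (Q : Assignment (numerosityStruct k) → Prop) : Prop :=
  ∀ (α : Type) [Finite α] (s : (α → k) → Assignment (numerosityStruct k)),
    DefinableAssignments A b s →
      ∃ C : Set (Set (α → k)), (∀ T ∈ C, A.Definable ring T) ∧ {v | Q (s v)} = ⋃₀ C

/-- For each parameter-free formula, its fibers form a family definable over ∅, so updating by them
adds nothing to `A`. Quantifying out the fiber parameters commutes with unions, and the formulas
contribute one more union. -/
theorem IsUnionOfDefinable.exists_rel {b : ℕ} {Q : Assignment (numerosityStruct k) → Prop}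
    (hQ : IsUnionOfDefinable A b Q) (n R : ℕ) :
    IsUnionOfDefinable A b fun s => ∃ B, Q (s.updateRel n R B) := by
  intro α _ s hs
  have hfib : ∀ p : Σ m, ring.Formula (Fin (n + 1) ⊕ Fin m),
      DefinableAssignments A b fun w : α ⊕ Fin p.1 → k =>
        (s (w ∘ Sum.inl)).updateRel n R (fiber p.2 (w ∘ Sum.inr)) := by
    intro p
    refine (hs.comp Sum.inl).updateRel n R (Definable.mono ?_ (empty_subset A))
    refine empty_definable_iff.2 ⟨p.2.relabel (Sum.map id Sum.inr), ?_⟩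
    ext w
    rw [mem_ofPred_eq, mem_ofPred_eq, Formula.realize_relabel]
    refine iff_of_eq (congrArg p.2.Realize ?_)
    funext i
    rcases i with i | i <;> rfl
  choose C hC hCQ using fun p => hQ _ _ (hfib p)
  refine ⟨{T | ∃ p, ∃ T' ∈ C p, T = {v | ∃ a, Sum.elim v a ∈ T'}}, ?_, ?_⟩
  · rintro _ ⟨p, T', hT', rfl⟩
    exact (hC p T' hT').exists_of_finite
  · have hmem : ∀ p v a, Q ((s v).updateRel n R (fiber p.2 a)) ↔ Sum.elim v a ∈ ⋃₀ C p :=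
      fun p v a => by rw [← hCQ p]; rfl
    ext v
    constructor
    · rintro ⟨B, hB⟩
      obtain ⟨m, θ, a, rfl⟩ := exists_fiber_eq B
      obtain ⟨T', hT', ha⟩ := (hmem ⟨m, θ⟩ v a).1 hB
      exact ⟨_, ⟨⟨m, θ⟩, T', hT', rfl⟩, a, ha⟩
    · rintro ⟨_, ⟨p, T', hT', rfl⟩, a, ha⟩
      exact ⟨fiber p.2 a, (hmem p v a).2 ⟨T', hT', ha⟩⟩

theorem Formula.IsSigma11.isUnionOfDefinable [IsAlgClosed k] (hk : Saturated ring k)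
    (hA : A.Finite) {b : ℕ} {φ : Formula} (hφ : φ.IsSigma11) (hb : φ.Below b) :
    IsUnionOfDefinable A b fun s => φ.Sat s := by
  induction hφ with
  | arith h =>
    exact fun _ _ s hs => ⟨{_}, by rintro _ rfl; exact hs.definable_sat hk hA h hb, by simp⟩
  | exRel n R h ih => exact IsUnionOfDefinable.exists_rel (ih hb) n R

theorem Formula.IsPi11.isUnionOfDefinable_not [IsAlgClosed k] (hk : Saturated ring k)
    (hA : A.Finite) {b : ℕ} {φ : Formula} (hφ : φ.IsPi11) (hb : φ.Below b) :
    IsUnionOfDefinable A b fun s => ¬ φ.Sat s := by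
  induction hφ with
  | arith h =>
    exact fun _ _ s hs => ⟨{_}, by rintro _ rfl; exact definable_not (hs.definable_sat hk hA h hb),
      by simp⟩
  | @allRel n R φ h ih =>
    have hφ : ∀ s : Assignment (numerosityStruct k),
        (¬ (Formula.allRel n R φ).Sat s) = ∃ B, ¬ φ.Sat (s.updateRel n R B) :=
      fun s => propext not_forall
    simp only [hφ]
    exact IsUnionOfDefinable.exists_rel (ih hb) n R

theorem exists_definableAssignments (s : Assignment (numerosityStruct k)) (b : ℕ) {n : ℕ}
    {x : Fin n → ℕ} (hx : Function.Injective x) :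
    ∃ A : Set k, A.Finite ∧ DefinableAssignments A b fun v => s.updateObjs x v := by
  choose P hP using fun n R => (definable_iff_finitely_definable.1 (s.rel n R).2)
  -- Parameters for the finitely many relations with arity index and variable below b, together with
  -- the values of the object variables below b.
  let A : Set k := (⋃ n ∈ Iio b, ⋃ R ∈ Iio b, (P n R : Set k)) ∪ s.obj '' Iio b
  refine ⟨A, ?_, ⟨fun y hy => ?_, fun n hn R hR => ?_⟩⟩
  · exact ((finite_Iio b).biUnion fun n _ => (finite_Iio b).biUnion fun R _ =>
      (P n R).finite_toSet).union ((finite_Iio b).image _)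
  · by_cases h : ∃ i, x i = y
    · obtain ⟨i, rfl⟩ := h
      simpa [Assignment.updateObjs, hx.extend_apply] using
        definable_coord_eq (Sum.inl i) (Sum.inr 0)
    · simp only [Assignment.updateObjs, Function.extend_apply' _ _ _ h]
      simp only [eq_comm (a := s.obj y)]
      exact definable_coord_eq_const _ (Or.inr ⟨y, hy, rfl⟩)
  · refine DefinableFamily.const ((hP n R).2.mono fun p hp => Or.inl ?_)
    exact mem_biUnion hn (mem_biUnion hR hp)

/-- The extension of φ and its complement, given by the failure of ψ, are both unions of
`A`-definable sets. In a finite subcover, the pieces inside the extension have exactly the extension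
as their union. -/
theorem models_delta11Comprehension [IsAlgClosed k] (hk : Saturated ring k) :
    (numerosityStruct k).Models delta11Comprehension := by
  have := IsAlgClosed.instInfinite (K := k)
  rintro _ ⟨n, x, R, φ, ψ, hx, hφ, hψ, hφR, -, rfl⟩ s hiff
  rw [Formula.sat_allObjs hx] at hiff
  simp only [Formula.sat_iff] at hiff
  obtain ⟨b₁, hb₁⟩ := φ.exists_below
  obtain ⟨b₂, hb₂⟩ := ψ.exists_below
  obtain ⟨A, hA, hs⟩ := exists_definableAssignments s (max b₁ b₂) hx
  obtain ⟨C, hC, hCφ⟩ := hφ.isUnionOfDefinable hk hA (hb₁.mono (le_max_left _ _)) _ _ hs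
  obtain ⟨C', hC', hCψ⟩ := hψ.isUnionOfDefinable_not hk hA (hb₂.mono (le_max_right _ _)) _ _ hs
  obtain ⟨D, hDC, hDf, hD⟩ := hk.exists_finite_subcover hA (C := C ∪ C')
    (fun T hT => hT.elim (hC T) (hC' T)) (by
      rw [sUnion_union, ← hCφ, ← hCψ]
      refine eq_univ_of_forall fun v => ?_
      by_cases hv : φ.Sat (s.updateObjs x v)
      · exact Or.inl hv
      · exact Or.inr fun h => hv ((hiff v).2 h))
  rw [Formula.sat_comprehension hx hφR]
  have hfin := (hDf.inter_of_left C).to_subtype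
  have h : (univ : Set k).Definable ring
      {v | ∃ T : (D ∩ C : Set (Set (Fin (n + 1) → k))), v ∈ T.1} :=
    definable_exists_index fun T => (hC T T.2.2).mono (subset_univ A)
  convert! h using 1
  ext v
  constructor
  · intro hv
    obtain ⟨T, hT, hvT⟩ := (hD ▸ mem_univ v : v ∈ ⋃₀ D)
    rcases hDC hT with hTC | hTC
    · exact ⟨⟨T, hT, hTC⟩, hvT⟩
    · have : v ∈ {v | ¬ ψ.Sat (s.updateObjs x v)} := hCψ ▸ ⟨T, hTC, hvT⟩
      exact absurd ((hiff v).1 hv) this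
  · rintro ⟨T, hvT⟩
    exact hCφ ▸ (⟨T.1, T.2.2, hvT⟩ : v ∈ ⋃₀ C)

end Definability

end SecondOrder

/-! ### Hume's Principle in the structure and failure of Π¹₁-comprehension -/

namespace SecondOrder

open Set ModelTheoretic FirstOrder.Language

section Bijection

variable {M : Type*} {N : Struct M}

theorem comp_vec_one {γ : Type*} (f : ℕ → γ) (a : ℕ) : f ∘ ![a] = ![f a] := by
  ext i
  fin_cases i
  rfl

theorem comp_vec_two {γ : Type*} (f : ℕ → γ) (a b : ℕ) : f ∘ ![a, b] = ![f a, f b] := by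
  ext i
  fin_cases i <;> rfl

theorem sat_bijection (s : Assignment N) (f X Y : ℕ) : (bijection f X Y).Sat s ↔
    IsBijectionGraph (s.rel 1 f).1 (s.rel 0 X).1 (s.rel 0 Y).1 := by
  have h1 : ∀ (t : Assignment N) (a A : ℕ), (Formula.memVars ![a] A).Sat t ↔
      ![t.obj a] ∈ (t.rel 0 A).1 := fun t a A => by
    rw [Formula.sat_memVars, comp_vec_one]
  have h2 : ∀ (t : Assignment N) (a b A : ℕ), (Formula.memVars ![a, b] A).Sat t ↔
      ![t.obj a, t.obj b] ∈ (t.rel 1 A).1 := fun t a b A => by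
    rw [Formula.sat_memVars, comp_vec_two]
  simp only [bijection, Formula.sat_and, Formula.Sat, h1, h2, Term.eval, Assignment.updateObj]
  simp only [Function.update_self, ne_eq, zero_ne_one, OfNat.zero_ne_ofNat, OfNat.one_ne_ofNat,
    not_false_eq_true, Function.update_of_ne, one_ne_zero]
  exact ⟨fun ⟨h1, h2, h3, h4, h5⟩ => ⟨h1, h2, h3, h4, h5⟩,
    fun ⟨h1, h2, h3, h4, h5⟩ => ⟨h1, h2, h3, h4, h5⟩⟩

end Bijection

section Numerosity

variable {k : Type*} [Field k] [IsAlgClosed k] [CharZero k] [FirstOrder.Ring.CompatibleRing k]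

theorem sat_humesPrinciple (hk : Saturated ring k) (s : Assignment (numerosityStruct k)) :
    humesPrinciple.Sat s := by
  intro X Y
  rw [Formula.sat_iff]
  have h : ∀ B, (bijection 0 0 1).Sat
      (((s.updateRel 0 0 X).updateRel 0 1 Y).updateRel 1 0 B) ↔ IsBijectionGraph B.1 X.1 Y.1 :=
    fun B => by rw [sat_bijection]; rfl
  have h' : (Formula.exRel 1 0 (bijection 0 0 1)).Sat
      ((s.updateRel 0 0 X).updateRel 0 1 Y) ↔
      ∃ G : Set (Fin 2 → k), (univ : Set k).Definable ring G ∧ IsBijectionGraph G X.1 Y.1 :=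
    ⟨fun ⟨B, hB⟩ => ⟨B.1, B.2, (h B).1 hB⟩, fun ⟨G, hG, hGb⟩ => ⟨⟨G, hG⟩, (h ⟨G, hG⟩).2 hGb⟩⟩
  rw [h']
  exact hk.numerosity_eq_iff X.2 Y.2

theorem models_delta11HP (hk : Saturated ring k) : (numerosityStruct k).Models Delta11HP := by
  rintro φ (rfl | hφ) s
  · exact sat_humesPrinciple hk s
  · exact models_delta11Comprehension hk φ hφ s

instance (M : Type*) [Nonempty M] (L : FirstOrder.Language) [L.Structure M]
    (d : definableSets L M 1 → M) : Nonempty (Assignment (definableStruct L M d)) :=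
  ⟨⟨fun _ => Classical.arbitrary M, fun _ _ => ⟨∅, definable_empty⟩⟩⟩

/-- The set of objects that are not the number of any set is neither finite nor cofinite, because
all values of `#` are integers and every natural number is a value. -/
theorem not_models_pi11HP (hk : Saturated ring k) : ¬ (numerosityStruct k).Models Pi11HP := by
  have := IsAlgClosed.instInfinite (K := k)
  intro h
  let φ : Formula := .allRel 0 0 (Formula.eq (.num 0) (.obj 0)).not
  have hx : Function.Injective (fun _ : Fin 1 => 0) := Function.injective_of_subsingleton _
  have hR : ¬ φ.RelFree 0 1 := by
    simp [φ, Formula.RelFree, Formula.not, Term.HasSetVar]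
  obtain ⟨s⟩ : Nonempty (Assignment (numerosityStruct k)) := inferInstance
  have hs := h (comprehension (fun _ : Fin 1 => 0) 1 φ)
    (Or.inr ⟨0, _, 1, φ, hx, .allRel 0 0 (.arith ⟨trivial, trivial⟩), hR, rfl⟩) s
  rw [Formula.sat_comprehension hx hR] at hs
  have hφ : ∀ v : Fin 1 → k, φ.Sat (s.updateObjs (fun _ : Fin 1 => 0) v) ↔
      ∀ X : definableSets ring k 1, numerosity X.1 ≠ v 0 := by
    intro v
    have hv : (s.updateObjs (fun _ : Fin 1 => 0) v).obj 0 = v 0 := hx.extend_apply v s.obj 0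
    refine forall_congr' fun X => not_congr ?_
    change numerosity _ = (s.updateObjs (fun _ : Fin 1 => 0) v).obj 0 ↔ _
    rw [hv, Assignment.updateRel_rel_self]
  have hnat : ∀ n : ℕ, ∃ X : definableSets ring k 1, numerosity X.1 = (n : k) := by
    intro n
    obtain ⟨t, ht⟩ := Infinite.exists_subset_card_eq (Fin 1 → k) n
    refine ⟨⟨t, definable_of_finite t.finite_toSet⟩, ?_⟩
    rw [numerosity_of_finite t.finite_toSet, ncard_coe_finset, ht]
  have hint : ∀ X : definableSets ring k 1, ∃ z : ℤ, numerosity X.1 = (z : k) := by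
    intro X
    rcases hk.finite_or_finite_compl X.2 with hX | hX
    · exact ⟨X.1.ncard, by rw [numerosity_of_finite hX, Int.cast_natCast]⟩
    · exact ⟨-(X.1ᶜ.ncard + 1), by rw [numerosity_of_finite_compl hX]; push_cast; rfl⟩
  have hinj : ∀ c : k, Function.Injective fun (n : ℕ) (_ : Fin 1) => (n : k) + c := by
    intro c m n hmn
    exact Nat.cast_injective (add_right_cancel (congrFun hmn 0))
  rcases hk.finite_or_finite_compl hs with hf | hf
  -- The numbers n + 1/2 are not integers, so infinitely many objects satisfy φ.
  · refine infinite_range_of_injective (hinj 2⁻¹) (hf.subset ?_)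
    rintro _ ⟨n, rfl⟩
    refine (hφ _).2 fun X hX => ?_
    obtain ⟨z, hz⟩ := hint X
    rw [hz] at hX
    have h2 : ((2 * z : ℤ) : k) = ((2 * n + 1 : ℤ) : k) := by
      push_cast
      rw [hX]
      field_simp
    have := Int.cast_injective h2
    omega
  · refine infinite_range_of_injective (hinj 0) (hf.subset ?_)
    rintro _ ⟨n, rfl⟩ hn
    obtain ⟨X, hX⟩ := hnat n
    exact (hφ _).1 hn X (hX.trans (add_zero _).symm)

end Numerosity

/-! ### Failure of Σ¹₁-choice -/

section SquareRoot

variable {k : Type*} [Field k] [IsAlgClosed k] [CharZero k] [FirstOrder.Ring.CompatibleRing k]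

/-- A saturated algebraically closed field has no definable square root function. -/
theorem _root_.ModelTheoretic.Saturated.not_definable_sqrt (hk : Saturated ring k) {f : k → k}
    (hf : (univ : Set k).Definable ring {v : Fin 2 → k | f (v 0) = v 1})
    (hsq : ∀ x, f x * f x = x) : False := by
  have := IsAlgClosed.instInfinite (K := k)
  obtain ⟨A, -, hfA⟩ := definable_iff_finitely_definable.1 hf
  obtain ⟨t, ht⟩ := hk.exists_transcendental A.finite_toSet
  have ht' : Transcendental (Subring.closure (A : Set k)) (-t) := fun h => ht (by simpa using h.neg)
  -- σ preserves the graph of f and fixes t², so it fixes f(t²) = ±t; but it negates t.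
  obtain ⟨σ, hσA, hσ⟩ := hk.exists_ringEquiv A.finite_toSet ht ht'
  have h0 : t ≠ 0 := fun h => ht (h ▸ isAlgebraic_zero)
  have hroot : f (t * t) = t ∨ f (t * t) = -t := mul_self_eq_mul_self_iff.1 (hsq _)
  have hσf : f (σ (t * t)) = σ (f (t * t)) :=
    hfA.map_mem_of_ringEquiv σ hσA
      (show ![t * t, f (t * t)] ∈ {v : Fin 2 → k | f (v 0) = v 1} from rfl)
  rw [map_mul, hσ, neg_mul_neg] at hσf
  rcases hroot with h | h
  · rw [h, hσ] at hσf
    exact h0 (self_eq_neg.1 hσf)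
  · rw [h, map_neg, hσ, neg_neg] at hσf
    exact h0 (neg_eq_self.1 hσf)

/-- Choice is applied to "P = {c} with c² = x". The language has no ring operations, so the squaring
relation is supplied as the value of a free binary variable. The chosen `R` would be the graph of a
square root function. -/
theorem not_models_sigma11PH (hk : Saturated ring k) : ¬ (numerosityStruct k).Models Sigma11PH := by
  intro h
  let φ : Formula := .exObj 2 ((Formula.memVars ![2, 0] 1).and
    (.allObj 1 ((Formula.memVars ![1] 0).iff (.eq (.obj 1) (.obj 2)))))
  have hsqdef : (∅ : Set k).Definable ring {v : Fin 2 → k | v 0 * v 0 = v 1} := by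
    refine empty_definable_iff.2 ⟨((Term.var 0 * Term.var 0 : ring.Term (Fin 2))).equal
      (Term.var 1), ?_⟩
    ext v
    simp
  let Sq : (numerosityStruct k).rel 1 := ⟨_, hsqdef.mono (empty_subset univ)⟩
  obtain ⟨s₀⟩ : Nonempty (Assignment (numerosityStruct k)) := inferInstance
  let s := s₀.updateRel 1 1 Sq
  have hφ : ∀ t : Assignment (numerosityStruct k), φ.Sat t ↔
      ∃ c, ![c, t.obj 0] ∈ (t.rel 1 1).1 ∧ ∀ a, ![a] ∈ (t.rel 0 0).1 ↔ a = c := by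
    intro t
    refine exists_congr fun c => ?_
    rw [Formula.sat_and, Formula.sat_memVars, comp_vec_two]
    refine and_congr Iff.rfl (forall_congr' fun a => ?_)
    rw [Formula.sat_iff, Formula.sat_memVars, comp_vec_one]
    rfl
  have hinj : ∀ i : ℕ, Function.Injective ![i] := fun i => Function.injective_of_subsingleton _
  obtain ⟨R, hR⟩ := h _ (Or.inr ⟨0, 0, ![0], ![1], 0, 0, φ, by decide,
    .arith (by simp [φ, Formula.IsArithmetical, Formula.not, Formula.and, Formula.iff,
      Formula.memVars]), by
      simp [φ, Formula.RelFree, Formula.not, Formula.and, Formula.iff, Formula.memVars,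
        Term.HasSetVar], rfl⟩) s (by
    rw [Formula.sat_allObjs (hinj 0)]
    intro v
    obtain ⟨c, hc⟩ := IsAlgClosed.exists_eq_mul_self (v 0)
    refine ⟨⟨{![c]}, definable_of_finite (finite_singleton _)⟩, (hφ _).2 ⟨c, ?_, fun a => ?_⟩⟩
    · rw [Assignment.updateRel_rel_of_ne _ _ (by simp)]
      have hv : (s.updateObjs ![0] v).obj 0 = v 0 := (hinj 0).extend_apply v s.obj 0
      change ![c, (s.updateObjs ![0] v).obj 0] ∈ (s.rel 1 1).1
      rw [hv, Assignment.updateRel_rel_self]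
      exact hc.symm
    · rw [Assignment.updateRel_rel_self]
      exact ⟨fun h => congrFun h 0, fun h => congrArg (fun b => ![b]) h⟩)
  rw [Formula.sat_allObjs (hinj 0)] at hR
  have hsqrt : ∀ x, ∃ c, c * c = x ∧ ∀ a, ![x, a] ∈ R.1 ↔ a = c := by
    intro x
    -- The slice of `R` at x has to be definable to be an admissible value of `P` in the conclusion
    -- of choice.
    have hP : (univ : Set k).Definable ring {w : Fin 1 → k | ![x, w 0] ∈ R.1} := by
      refine Definable.preimage_map (F := fun w : Fin 1 → k => ![x, w 0]) (fun i => ?_) R.2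
      fin_cases i
      · exact definableFun_const _ _ (mem_univ x)
      · exact DefinableFun.proj ring
    let t := (s.updateRel 1 0 R).updateObjs ![0] ![x]
    have ht : t.obj 0 = x := (hinj 0).extend_apply ![x] s.obj 0
    obtain ⟨c, hc, hcR⟩ := (hφ _).1 (hR ![x] ⟨_, hP⟩ (by
      rw [Formula.sat_allObjs (hinj 1)]
      intro w
      have h0 : ((t.updateRel 0 0 ⟨_, hP⟩).updateObjs ![1] w).obj 0 = x :=
        (Function.extend_apply' _ _ _ (by simp)).trans ht
      have h1 : ((t.updateRel 0 0 ⟨_, hP⟩).updateObjs ![1] w).obj 1 = w 0 :=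
        (hinj 1).extend_apply w _ 0
      have happ : (Fin.append ![0] ![1] : Fin 2 → ℕ) = ![0, 1] := by decide
      rw [Formula.sat_iff, Formula.sat_memVars, Formula.sat_memVars]
      erw [happ, comp_vec_two, comp_vec_one, h0, h1]
      rfl))
    refine ⟨c, ?_, fun a => ?_⟩
    · rw [Assignment.updateRel_rel_of_ne _ _ (by simp)] at hc
      change ![c, t.obj 0] ∈ ((s.updateRel 1 0 R).rel 1 1).1 at hc
      rw [ht, Assignment.updateRel_rel_of_ne _ _ (by simp), Assignment.updateRel_rel_self] at hc
      exact hc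
    · rw [← hcR a, Assignment.updateRel_rel_self]
      rfl
  choose f hf hfR using hsqrt
  refine hk.not_definable_sqrt (f := f) ?_ hf
  convert! R.2 using 1
  ext v
  have hv : v = ![v 0, v 1] := by ext i; fin_cases i <;> rfl
  rw [hv, hfR]
  exact eq_comm

end SquareRoot

/-! ### Inconsistency of Basic Law V with definable relations -/

section BasicLawV

variable {k : Type*} [Field k] [IsAlgClosed k] [CharZero k] [FirstOrder.Ring.CompatibleRing k]

/-- Basic Law V makes d injective, and Δ¹₁-comprehension makes the graph of a ↦ d{a} definable. By
Ax-Grothendieck this injection is onto, so d{a} = d∅ for some a, against injectivity. -/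
theorem not_models_delta11BL (d : definableSets ring k 1 → k) :
    ¬ (definableStruct ring k d).Models Delta11BL := by
  intro h
  let N := definableStruct ring k d
  obtain ⟨s⟩ : Nonempty (Assignment N) := inferInstance
  have hinj : Function.Injective d := by
    intro X Y hXY
    have := h basicLawV (Or.inl rfl) s X Y
    rw [Formula.sat_iff] at this
    exact this.1 hXY
  let sing : Formula := .allObj 2 ((Formula.memVars ![2] 0).iff (.eq (.obj 2) (.obj 0)))
  -- The singleton of a given object is unique, so "some" and "every" such set give equivalent Σ¹₁
  -- and Π¹₁ descriptions of the graph.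
  let φ : Formula := .exRel 0 0 (sing.and (.eq (.num 0) (.obj 1)))
  let ψ : Formula := .allRel 0 0 (sing.imp (.eq (.num 0) (.obj 1)))
  let S : k → definableSets ring k 1 := fun a =>
    ⟨{![a]}, definable_of_finite (finite_singleton _)⟩
  have hx : Function.Injective ![0, 1] := by decide
  have hS : ∀ (a : k) (X : definableSets ring k 1), X = S a ↔ ∀ b, ![b] ∈ X.1 ↔ b = a := by
    intro a X
    rw [Subtype.ext_iff, Set.ext_iff]
    refine ⟨fun h b => (h ![b]).trans ⟨fun hb => congrFun hb 0,
      fun hb => congrArg (fun c => ![c]) hb⟩, fun h v => ?_⟩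
    rw [← vec_one_eq v, h]
    exact ⟨fun hb => congrArg (fun c => ![c]) hb, fun hb => congrFun hb 0⟩
  have hsing : ∀ (t : Assignment N) (X : definableSets ring k 1),
      sing.Sat (t.updateRel 0 0 X) ↔ X = S (t.obj 0) := by
    intro t X
    rw [hS]
    refine forall_congr' fun a => ?_
    rw [Formula.sat_iff, Formula.sat_memVars, comp_vec_one]
    rfl
  have hφ : ∀ t : Assignment N, φ.Sat t ↔ d (S (t.obj 0)) = t.obj 1 := by
    intro t
    have : φ.Sat t ↔ ∃ X, X = S (t.obj 0) ∧ d X = t.obj 1 := exists_congr fun X =>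
      (Formula.sat_and _ _ _).trans (and_congr (hsing t X) Iff.rfl)
    rw [this, exists_eq_left]
  have hψ : ∀ t : Assignment N, ψ.Sat t ↔ d (S (t.obj 0)) = t.obj 1 := by
    intro t
    have : ψ.Sat t ↔ ∀ X, X = S (t.obj 0) → d X = t.obj 1 := forall_congr' fun X =>
      imp_congr (hsing t X) Iff.rfl
    rw [this, forall_eq]
  have hRφ : ¬ φ.RelFree 1 0 := by
    simp [φ, sing, Formula.RelFree, Formula.not, Formula.and, Formula.iff, Formula.memVars]
  have hRψ : ¬ ψ.RelFree 1 0 := by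
    simp [ψ, sing, Formula.RelFree, Formula.not, Formula.and, Formula.iff, Formula.memVars]
  have hsa : sing.IsArithmetical :=
    ⟨⟨⟨trivial, trivial⟩, ⟨trivial, trivial⟩, trivial⟩, trivial⟩
  have hcomp := h _ (Or.inr ⟨1, ![0, 1], 0, φ, ψ, hx,
    .exRel 0 0 (.arith ⟨⟨hsa, trivial, trivial⟩, trivial⟩),
    .allRel 0 0 (.arith ⟨hsa, trivial⟩), hRφ, hRψ, rfl⟩) s (by
      rw [Formula.sat_allObjs hx]
      intro v
      rw [Formula.sat_iff, hφ, hψ])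
  rw [Formula.sat_comprehension hx hRφ] at hcomp
  have hdef : (univ : Set k).Definable ring {v : Fin 2 → k | d (S (v 0)) = v 1} := by
    convert! hcomp using 1
    ext v
    rw [mem_ofPred_eq, mem_ofPred_eq, hφ]
    have h0 : (s.updateObjs ![0, 1] v).obj 0 = v 0 := hx.extend_apply v s.obj 0
    have h1 : (s.updateObjs ![0, 1] v).obj 1 = v 1 := hx.extend_apply v s.obj 1
    rw [h0, h1]
  obtain ⟨a, ha⟩ := FirstOrder.Ring.surjective_of_injective_of_definable
    (f := fun a => d (S a)) hdef (fun a b hab => ((hS b _).1 (hinj hab) a).1 rfl)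
    (d ⟨∅, definable_empty⟩)
  have hmem : ![a] ∈ (S a).1 := rfl
  rw [hinj ha] at hmem
  exact hmem

end BasicLawV

end SecondOrder

theorem mainTheorem6 {k : Type u} [Field k] [IsAlgClosed k] [CharZero k]
    [FirstOrder.Ring.CompatibleRing k]
    (hk : ModelTheoretic.Saturated FirstOrder.Language.ring k) :
    (∃ num : ModelTheoretic.definableSets FirstOrder.Language.ring k 1 → k,
      (∀ X : ModelTheoretic.definableSets FirstOrder.Language.ring k 1,
        (X.1.Finite ∧ num X = (X.1.ncard : k)) ∨
          (X.1ᶜ.Finite ∧ num X = -((X.1ᶜ.ncard : k) + 1))) ∧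
      ModelTheoretic.UniformlyDefinable FirstOrder.Language.ring k num ∧
      (SecondOrder.definableStruct FirstOrder.Language.ring k num).Models
        SecondOrder.Delta11HP ∧
      ¬ (SecondOrder.definableStruct FirstOrder.Language.ring k num).Models
        SecondOrder.Sigma11PH ∧
      ¬ (SecondOrder.definableStruct FirstOrder.Language.ring k num).Models
        SecondOrder.Pi11HP) ∧
    ¬ ∃ d : ModelTheoretic.definableSets FirstOrder.Language.ring k 1 → k,
      (SecondOrder.definableStruct FirstOrder.Language.ring k d).Models
        SecondOrder.Delta11BL := by
  have := IsAlgClosed.instInfinite (K := k)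
  refine ⟨⟨fun X => ModelTheoretic.numerosity X.1, fun X => ?_,
    hk.uniformlyDefinable_numerosity, SecondOrder.models_delta11HP hk,
    SecondOrder.not_models_sigma11PH hk, SecondOrder.not_models_pi11HP hk⟩,
    fun ⟨d, hd⟩ => SecondOrder.not_models_delta11BL d hd⟩
  exact (hk.finite_or_finite_compl X.2).imp
    (fun h => ⟨h, ModelTheoretic.numerosity_of_finite h⟩)
    (fun h => ⟨h, ModelTheoretic.numerosity_of_finite_compl h⟩)
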